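/- Let $d\ge 1$ and let $M\subset\mathbb R^d$ be a closed (that is, compact and without boundary) embedded hypersurface of class $C^3$, with $(d-1)$-dimensional surface measure $\sigma$. For $y\in M$ let $T_yM\subset\mathbb R^d$ be the tangent space and $P(y)$ the orthogonal projection of $\mathbb R^d$ onto $T_yM$. For $x\in\mathbb R^d$ let $\mathrm{cp}(x)\in M$ be a Euclidean closest point of $M$ to $x$ (unique for $x$ near $M$). For functions $v:M\to\mathbb R$ and vector fields $g:M\to\mathbb R^d$ define, at $y\in M$, $$\nabla_M v(y):=P(y)\,\nabla(v\circ\mathrm{cp})(y),\qquad \nabla_M\cdot g(y):=(P(y)\nabla)\cdot(g\circ\mathrm{cp})(y)=\operatorname{tr}\bigl(P(y)\,D(g\circ\mathrm{cp})(y)\bigr).$$ Let $A:M\times[0,T]\to\mathbb R^{d\times d}$ be a diffusion tensor such that 1. $A(y,t)$ is symmetric and $A(y,t)\,T_yM\subset T_yM$ for all $y\in M$, $t\in[0,T]$; 2. there is $\nu>0$ with $\nu\|\xi\|^2\le\xi^{T}A(y,t)\xi\le\nu^{-1}\|\xi\|^2$ for all $y\in M$, $t\in[0,T]$, $\xi\in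 T_yM$; 3. for each $t\in[0,T]$ the entries of $A(\cdot,t)$ are $C^1$ on $M$. Let $v,w\in C^2(M)$. Then for every $t\in[0,T]$ the extensions $v\circ\mathrm{cp}$, $w\circ\mathrm{cp}$ and $(A(\cdot,t)\nabla_M w)\circ\mathrm{cp}$ are differentiable at every point of $M$, both integrands below are $\sigma$-integrable on $M$, and $$\int_M v\,\nabla_M\cdot\bigl(A(\cdot,t)\nabla_M w\bigr)\,d\sigma=-\int_M \nabla_M v\cdot\bigl(A(\cdot,t)\nabla_M w\bigr)\,d\sigma .$$ -/

import Mathlib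

open MeasureTheory
open scoped Gradient

noncomputable section

/-- `M ⊂ ℝ^(n+1)` is a closed (compact, without boundary) embedded hypersurface of class `C^k`:
near each of its points it is the zero set of a `C^k` function with non-vanishing differential. -/
structure IsClosedHypersurface {n : ℕ} (k : WithTop ℕ∞)
    (M : Set (EuclideanSpace ℝ (Fin (n + 1)))) : Prop where
  isCompact : IsCompact M
  exists_local_equation : ∀ y ∈ M, ∃ U : Set (EuclideanSpace ℝ (Fin (n + 1))),
    IsOpen U ∧ y ∈ U ∧ ∃ F : EuclideanSpace ℝ (Fin (n + 1)) → ℝ,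
      ContDiffOn ℝ k F U ∧ fderiv ℝ F y ≠ 0 ∧ M ∩ U = {x ∈ U | F x = 0}

/-- A Euclidean closest point of `M` to `x`. For closed nonempty `M` one always exists, and for
`x` close to a compact `C^2` hypersurface it is unique, so that the choice plays no role there. -/
def closestPoint {n : ℕ} (M : Set (EuclideanSpace ℝ (Fin (n + 1))))
    (x : EuclideanSpace ℝ (Fin (n + 1))) : EuclideanSpace ℝ (Fin (n + 1)) :=
  Classical.epsilon fun y => y ∈ M ∧ IsMinOn (fun z => ‖z - x‖) M y

/-- The tangent space of `M` at `y`, as a linear subspace of the ambient space. -/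
def tangentSpaceAt {n : ℕ} (M : Set (EuclideanSpace ℝ (Fin (n + 1))))
    (y : EuclideanSpace ℝ (Fin (n + 1))) : Submodule ℝ (EuclideanSpace ℝ (Fin (n + 1))) :=
  Submodule.span ℝ (tangentConeAt ℝ M y)

/-- The orthogonal projection `P(y)` of the ambient space onto the tangent space of `M` at `y`. -/
def tangentProj {n : ℕ} (M : Set (EuclideanSpace ℝ (Fin (n + 1))))
    (y : EuclideanSpace ℝ (Fin (n + 1))) :
    EuclideanSpace ℝ (Fin (n + 1)) →L[ℝ] EuclideanSpace ℝ (Fin (n + 1)) :=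
  (tangentSpaceAt M y).starProjection

/-- The surface gradient `P(y) ∇(v ∘ cp)(y)`. Only the values of `v` on `M` matter. -/
def surfaceGrad {n : ℕ} (M : Set (EuclideanSpace ℝ (Fin (n + 1))))
    (v : EuclideanSpace ℝ (Fin (n + 1)) → ℝ) (y : EuclideanSpace ℝ (Fin (n + 1))) :
    EuclideanSpace ℝ (Fin (n + 1)) :=
  tangentProj M y (∇ (v ∘ closestPoint M) y)

/-- The surface divergence `(P(y) ∇) ⬝ (g ∘ cp)(y) = ∑ i j, P(y)_{ij} ∂_j (g ∘ cp)_i (y)`, that is,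
the trace of `P(y)` times the Jacobian matrix of `g ∘ cp` at `y`.
Only the values of `g` on `M` matter. -/
def surfaceDiv {n : ℕ} (M : Set (EuclideanSpace ℝ (Fin (n + 1))))
    (g : EuclideanSpace ℝ (Fin (n + 1)) → EuclideanSpace ℝ (Fin (n + 1)))
    (y : EuclideanSpace ℝ (Fin (n + 1))) : ℝ :=
  LinearMap.trace ℝ (EuclideanSpace ℝ (Fin (n + 1)))
    (tangentProj M y ∘L fderiv ℝ (g ∘ closestPoint M) y).toLinearMap

/-- The surface measure `σ` of a hypersurface `M`: the `n`-dimensional Hausdorff measure, normalized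
so as to agree with Lebesgue measure on `ℝ^n`, restricted to `M`. -/
def surfaceMeasure {n : ℕ} (M : Set (EuclideanSpace ℝ (Fin (n + 1)))) :
    Measure (EuclideanSpace ℝ (Fin (n + 1))) :=
  (Measure.euclideanHausdorffMeasure n).restrict M

/-- `A : M × [0, T] → ℝ^{d × d}`, `d = n + 1`, is an admissible diffusion tensor: symmetric, leaving
the tangent spaces of `M` invariant, uniformly positive definite and bounded on them, and with
coefficients that are `C^1` in the space variable (`M` being compact, the first derivatives in
space are then bounded at each time). -/
structure IsDiffusionTensor {n : ℕ} (M : Set (EuclideanSpace ℝ (Fin (n + 1)))) (T : ℝ)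
    (A : EuclideanSpace ℝ (Fin (n + 1)) → ℝ → Matrix (Fin (n + 1)) (Fin (n + 1)) ℝ) : Prop where
  symm : ∀ y ∈ M, ∀ t ∈ Set.Icc 0 T, (A y t).IsSymm
  invariant : ∀ y ∈ M, ∀ t ∈ Set.Icc 0 T, ∀ ξ ∈ tangentSpaceAt M y,
    Matrix.toEuclideanLin (A y t) ξ ∈ tangentSpaceAt M y
  elliptic : ∃ ν : ℝ, 0 < ν ∧ ∀ y ∈ M, ∀ t ∈ Set.Icc 0 T, ∀ ξ ∈ tangentSpaceAt M y,
    ν * ‖ξ‖ ^ 2 ≤ inner ℝ ξ (Matrix.toEuclideanLin (A y t) ξ) ∧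
    inner ℝ ξ (Matrix.toEuclideanLin (A y t) ξ) ≤ ν⁻¹ * ‖ξ‖ ^ 2
  smooth : ∀ t ∈ Set.Icc 0 T, ∀ i j, ContDiffOn ℝ 1 (fun y => A y t i j) M

/-- The flux field `A(·, t) ∇_M w` on `M`. -/
def surfaceFlux {n : ℕ} (M : Set (EuclideanSpace ℝ (Fin (n + 1))))
    (A : EuclideanSpace ℝ (Fin (n + 1)) → ℝ → Matrix (Fin (n + 1)) (Fin (n + 1)) ℝ) (t : ℝ)
    (w : EuclideanSpace ℝ (Fin (n + 1)) → ℝ) (y : EuclideanSpace ℝ (Fin (n + 1))) :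
    EuclideanSpace ℝ (Fin (n + 1)) :=
  Matrix.toEuclideanLin (A y t) (surfaceGrad M w y)

end

/-! The surface operators are ordinary derivatives of closest-point extensions, so the identity is
reduced to calculus in thin tubes around M. The map cp is idempotent and its derivative on M is P,
so on M the derivative of f ∘ cp already factors through P. Hence `surfaceGrad` and `surfaceDiv` are
the plain gradient and divergence of the extensions. By the product rule the two integrands add up
to the surface divergence of the tangential field v A ∇w, and what remains is the divergence theorem
∫ div g = 0 for tangential g (`integral_surfaceDiv_eq_zero`).

For this put Z = g ∘ cp. Near M the vector x - cp x is normal to M at cp x, hence orthogonal to Z x,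
and it is half the gradient of the squared distance to M. A cutoff χ that depends only on the
distance therefore satisfies div(χ Z) = χ div Z, and the integral of the left side over the whole
space is zero. Letting χ tend to the indicator of the ε-tube gives ∫ div Z = 0 over every thin tube
(`setIntegral_trace_fderiv_thickening_eq_zero`). Division by 2ε and ε → 0 then yield the surface
integral.

Two facts carry the argument. By the inverse function theorem cp is C^2 near M and comes with a C^2
unit normal and signed distance (`exists_isNormalCoordinates`). And Lebesgue measure on the ε-tube,
pushed to M by cp, is 2ε times Hausdorff measure up to a factor tending to 1
(`exists_tubeMeasure_le`): a small piece of tube is mapped almost isometrically onto a right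
cylinder over a piece of tangent plane, where the product formula is exact. -/

section
open Filter Topology Metric Set InnerProductSpace

/-! ### Normals to level sets and the linearized normal map -/

section NormalMap

variable {E : Type*} [NormedAddCommGroup E] [InnerProductSpace ℝ E]

/-- At a point of a level set of `F` closest to `x`, the direction to `x` is normal. -/
lemma sub_eq_inner_smul_of_isLocalMinOn {F : E → ℝ} [CompleteSpace E] {x y ν : E} {c : ℝ}
    (hc : c ≠ 0) (hν : ‖ν‖ = 1)
    (hF : HasStrictFDerivAt F (c • innerSL ℝ ν) y)
    (hmin : IsLocalMinOn (fun z => ‖z - x‖) {z | F z = F y} y) :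
    x - y = inner ℝ ν (x - y) • ν := by
  have hφ : HasStrictFDerivAt (fun z => ‖z - x‖ ^ 2) (2 • innerSL ℝ (y - x)) y := by
    have := (hasStrictFDerivAt_norm_sq (y - x)).comp y ((hasStrictFDerivAt_id y).sub_const x)
    exact this
  have hmin' : IsLocalMinOn (fun z => ‖z - x‖ ^ 2) {z | F z = F y} y := by
    filter_upwards [hmin] with z hz
    gcongr
  -- Lagrange multipliers: the differentials of F and of the squared distance to x are linearly
  -- dependent at y.
  obtain ⟨a, b, hab, h⟩ :=
    IsLocalExtrOn.exists_multipliers_of_hasStrictFDerivAt_1d (Or.inl hmin') hF hφ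
  have hvec : ∀ w : E, a * (c * inner ℝ ν w) + b * (2 * inner ℝ (y - x) w) = 0 := by
    intro w
    have := congrArg (fun l : E →L[ℝ] ℝ => l w) h
    simpa [inner_sub_left] using this
  have hνν : inner ℝ ν ν = (1 : ℝ) := by rw [real_inner_self_eq_norm_sq, hν]; norm_num
  have hb : b ≠ 0 := by
    rintro rfl
    have := hvec ν
    rw [hνν] at this
    apply hab
    have ha : a = 0 := by
      have h' : a * c = 0 := by linarith
      exact (mul_eq_zero.mp h').resolve_right hc
    simp [ha]
  have hperp : ∀ w : E, inner ℝ ν w = 0 → inner ℝ (x - y) w = 0 := by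
    intro w hw
    have h1 := hvec w
    rw [hw] at h1
    have h2 : inner ℝ (y - x) w = 0 := by
      have : b * (2 * inner ℝ (y - x) w) = 0 := by linarith
      have := (mul_eq_zero.mp this).resolve_left hb
      linarith
    rw [← neg_sub, inner_neg_left, h2, neg_zero]
  -- The component of x - y orthogonal to ν is orthogonal to ν and, by `hperp`, to x - y, hence to
  -- itself.
  set w := x - y - inner ℝ ν (x - y) • ν with hw
  have hw0 : inner ℝ ν w = 0 := by
    rw [hw, inner_sub_right, inner_smul_right, hνν]; ring
  have : inner ℝ w w = 0 := by
    conv_lhs => rw [hw]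
    rw [inner_sub_left, inner_smul_left, hw0, hperp w hw0]; simp
  rw [inner_self_eq_zero] at this
  exact sub_eq_zero.mp this

/-- The derivative of `(y, s) ↦ (y + s • ν y, F y)` at `s = 0`, as an isomorphism. -/
noncomputable def normalMapDeriv (ν : E) (c : ℝ) (hc : c ≠ 0) (hν : ‖ν‖ = 1) :
    (E × ℝ) ≃L[ℝ] (E × ℝ) :=
  ContinuousLinearEquiv.equivOfInverse
    ((ContinuousLinearMap.fst ℝ E ℝ + (ContinuousLinearMap.snd ℝ E ℝ).smulRight ν).prod
      ((c • innerSL ℝ ν) ∘L ContinuousLinearMap.fst ℝ E ℝ))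
    ((ContinuousLinearMap.fst ℝ E ℝ - (innerSL ℝ ν ∘L ContinuousLinearMap.fst ℝ E ℝ
        - c⁻¹ • ContinuousLinearMap.snd ℝ E ℝ).smulRight ν).prod
      (innerSL ℝ ν ∘L ContinuousLinearMap.fst ℝ E ℝ - c⁻¹ • ContinuousLinearMap.snd ℝ E ℝ))
    (by
      rintro ⟨h, r⟩
      simp [inner_add_right, inner_smul_right, hν, hc])
    (by
      rintro ⟨h, r⟩
      simp [inner_sub_right, inner_smul_right, hν, hc])

end NormalMap

/-! ### The closest point map and normal coordinates -/

section ClosestPoint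

variable {n : ℕ} {M : Set (EuclideanSpace ℝ (Fin (n + 1)))}

lemma closestPoint_spec (hM : IsCompact M) (hne : M.Nonempty)
    (x : EuclideanSpace ℝ (Fin (n + 1))) :
    closestPoint M x ∈ M ∧ IsMinOn (fun z => ‖z - x‖) M (closestPoint M x) := by
  refine Classical.epsilon_spec
    (p := fun y => y ∈ M ∧ IsMinOn (fun z => ‖z - x‖) M y) ?_
  obtain ⟨y, hy, h⟩ := hM.exists_isMinOn hne (f := fun z => ‖z - x‖) (by fun_prop)
  exact ⟨y, hy, h⟩

lemma closestPoint_mem (hM : IsCompact M) (hne : M.Nonempty)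
    (x : EuclideanSpace ℝ (Fin (n + 1))) : closestPoint M x ∈ M :=
  (closestPoint_spec hM hne x).1

lemma norm_closestPoint_sub_le (hM : IsCompact M) {y : EuclideanSpace ℝ (Fin (n + 1))}
    (hy : y ∈ M) (x : EuclideanSpace ℝ (Fin (n + 1))) :
    ‖closestPoint M x - x‖ ≤ ‖y - x‖ :=
  (closestPoint_spec hM ⟨y, hy⟩ x).2 hy

lemma closestPoint_of_mem (hM : IsCompact M) {y : EuclideanSpace ℝ (Fin (n + 1))}
    (hy : y ∈ M) : closestPoint M y = y := by
  have := norm_closestPoint_sub_le hM hy y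
  rw [sub_self, norm_zero] at this
  exact sub_eq_zero.mp (norm_le_zero_iff.mp this)

lemma closestPoint_closestPoint (hM : IsCompact M) (hne : M.Nonempty)
    (x : EuclideanSpace ℝ (Fin (n + 1))) :
    closestPoint M (closestPoint M x) = closestPoint M x :=
  closestPoint_of_mem hM (closestPoint_mem hM hne x)

lemma norm_sub_closestPoint (hM : IsCompact M) (hne : M.Nonempty)
    (x : EuclideanSpace ℝ (Fin (n + 1))) : ‖x - closestPoint M x‖ = infDist x M := by
  apply le_antisymm
  · refine (le_infDist hne).2 fun y hy => ?_
    rw [norm_sub_rev, dist_comm, dist_eq_norm]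
    exact norm_closestPoint_sub_le hM hy x
  · rw [← dist_eq_norm]
    exact infDist_le_dist_of_mem (closestPoint_mem hM hne x)

/-- The triangle inequality gives |cp x - y| ≤ 2 |x - y| for y in M, whichever closest point was
chosen. -/
lemma tendsto_closestPoint (hM : IsCompact M) {y : EuclideanSpace ℝ (Fin (n + 1))}
    (hy : y ∈ M) : Tendsto (closestPoint M) (𝓝 y) (𝓝 y) := by
  rw [tendsto_iff_norm_sub_tendsto_zero]
  have h0 : Tendsto (fun x => 2 * ‖x - y‖) (𝓝 y) (𝓝 0) := by
    have : Continuous fun x : EuclideanSpace ℝ (Fin (n + 1)) => 2 * ‖x - y‖ := by fun_prop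
    simpa using this.tendsto y
  refine squeeze_zero (fun _ => norm_nonneg _) (fun x => ?_) h0
  have h1 := norm_closestPoint_sub_le hM hy x
  have h2 := norm_sub_le_norm_sub_add_norm_sub (closestPoint M x) x y
  rw [norm_sub_rev y x] at h1
  linarith

/-- `ν` is a unit normal field and `s` the signed distance of `M` near `y₀ ∈ M`, and
`x ↦ (closestPoint M x, s x)` is inverse to `(y, r) ↦ y + r • ν y`. -/
structure IsNormalCoordinates (M : Set (EuclideanSpace ℝ (Fin (n + 1))))
    (y₀ : EuclideanSpace ℝ (Fin (n + 1)))
    (ν : EuclideanSpace ℝ (Fin (n + 1)) → EuclideanSpace ℝ (Fin (n + 1)))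
    (s : EuclideanSpace ℝ (Fin (n + 1)) → ℝ) : Prop where
  contDiffAt_closestPoint : ContDiffAt ℝ 2 (closestPoint M) y₀
  contDiffAt_normal : ContDiffAt ℝ 2 ν y₀
  contDiffAt_dist : ContDiffAt ℝ 2 s y₀
  norm_normal : ∀ᶠ x in 𝓝 y₀, ‖ν x‖ = 1
  decomp : ∀ᶠ x in 𝓝 y₀, x = closestPoint M x + s x • ν (closestPoint M x)
  inner_fderiv : ∀ᶠ x in 𝓝 y₀, ∀ h,
    inner ℝ (ν (closestPoint M x)) (fderiv ℝ (closestPoint M) x h) = 0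
  inverse : ∀ᶠ p : EuclideanSpace ℝ (Fin (n + 1)) × ℝ in 𝓝 (y₀, 0), p.1 ∈ M →
    closestPoint M (p.1 + p.2 • ν p.1) = p.1 ∧ s (p.1 + p.2 • ν p.1) = p.2

/-- With ν the normalized gradient of a local equation F, the map (y, s) ↦ (y + s ν(y), F y) is a
local C^2 diffeomorphism. Lagrange multipliers show that it sends (cp x, s) to (x, 0) for a suitable
s, so cp and s are components of its inverse. One of the three derivatives of F is spent on ν. -/
lemma IsClosedHypersurface.exists_isNormalCoordinates (hM : IsClosedHypersurface 3 M)
    {y₀ : EuclideanSpace ℝ (Fin (n + 1))} (hy₀ : y₀ ∈ M) :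
    ∃ ν s, IsNormalCoordinates M y₀ ν s := by
  obtain ⟨U, hU, hyU, F, hF, hF0, hMU⟩ := hM.exists_local_equation y₀ hy₀
  have hne : M.Nonempty := ⟨y₀, hy₀⟩
  have hFat : ∀ z ∈ U, ContDiffAt ℝ 3 F z := fun z hz => hF.contDiffAt (hU.mem_nhds hz)
  have hgrad : ContDiffAt ℝ 2 (∇ F) y₀ := by
    have h1 : ContDiffAt ℝ 2 (fderiv ℝ F) y₀ := (hFat y₀ hyU).fderiv_right (by norm_num)
    exact (toDual ℝ (EuclideanSpace ℝ (Fin (n + 1)))).symm.contDiff.contDiffAt.comp y₀ h1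
  have hgrad0 : ∇ F y₀ ≠ 0 := by
    intro h
    apply hF0
    simpa [gradient] using h
  have hgne : ∀ᶠ z in 𝓝 y₀, ∇ F z ≠ 0 := hgrad.continuousAt.eventually_ne hgrad0
  set ν : EuclideanSpace ℝ (Fin (n + 1)) → EuclideanSpace ℝ (Fin (n + 1)) :=
    fun z => ‖∇ F z‖⁻¹ • ∇ F z with hνdef
  have hν : ContDiffAt ℝ 2 ν y₀ :=
    ((hgrad.norm ℝ hgrad0).inv (norm_ne_zero_iff.2 hgrad0)).smul hgrad
  have hν1 : ∀ z, ∇ F z ≠ 0 → ‖ν z‖ = 1 := fun z hz => by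
    simp [hνdef, norm_smul, hz]
  have hfd : ∀ z, ∇ F z ≠ 0 → fderiv ℝ F z = ‖∇ F z‖ • innerSL ℝ (ν z) := fun z hz => by
    ext w
    have : fderiv ℝ F z w = inner ℝ (∇ F z) w := by
      rw [gradient, toDual_symm_apply]
    rw [this]
    simp [hνdef, hz]
  -- The second component F makes source and target equidimensional, so the inverse function theorem
  -- applies in the ambient space without a chart of M.
  set Φ : EuclideanSpace ℝ (Fin (n + 1)) × ℝ → EuclideanSpace ℝ (Fin (n + 1)) × ℝ :=
    fun p => (p.1 + p.2 • ν p.1, F p.1) with hΦdef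
  have hFy₀ : F y₀ = 0 := by
    have : y₀ ∈ M ∩ U := ⟨hy₀, hyU⟩
    rw [hMU] at this
    exact this.2
  have hFM : ∀ z ∈ U, z ∈ M → F z = 0 := fun z hz hzM => by
    have : z ∈ M ∩ U := ⟨hzM, hz⟩
    rw [hMU] at this
    exact this.2
  have hΦ0 : Φ (y₀, 0) = (y₀, 0) := by simp [hΦdef, hFy₀]
  have hc : ‖∇ F y₀‖ ≠ 0 := norm_ne_zero_iff.2 hgrad0
  have hν' : ContDiffAt ℝ 2 (fun p : EuclideanSpace ℝ (Fin (n + 1)) × ℝ => ν p.1) (y₀, 0) :=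
    ContDiffAt.comp (y₀, (0 : ℝ)) (g := ν) hν contDiffAt_fst
  have hΦ : ContDiffAt ℝ 2 Φ (y₀, 0) := by
    refine ContDiffAt.prodMk (contDiffAt_fst.add (contDiffAt_snd.smul hν')) ?_
    exact ContDiffAt.comp (y₀, (0 : ℝ)) (g := F) ((hFat y₀ hyU).of_le (by norm_num))
      contDiffAt_fst
  have hΦd : HasFDerivAt Φ
      ((normalMapDeriv (ν y₀) ‖∇ F y₀‖ hc (hν1 _ hgrad0) : _ ≃L[ℝ] _) :
        EuclideanSpace ℝ (Fin (n + 1)) × ℝ →L[ℝ] _) (y₀, 0) := by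
    have h1 : HasFDerivAt (fun p : EuclideanSpace ℝ (Fin (n + 1)) × ℝ => ν p.1) _ (y₀, 0) :=
      (hν'.differentiableAt (by norm_num)).hasFDerivAt
    have h2 : HasFDerivAt F (fderiv ℝ F y₀) ((y₀, (0 : ℝ)).1) :=
      ((hFat y₀ hyU).differentiableAt (by norm_num)).hasFDerivAt
    have h3 := (hasFDerivAt_fst (𝕜 := ℝ) (p := (y₀, (0 : ℝ)))).add
      ((hasFDerivAt_snd (𝕜 := ℝ) (p := (y₀, (0 : ℝ)))).smul h1)
    have h4 := h3.prodMk (h2.comp (y₀, (0 : ℝ)) (hasFDerivAt_fst (𝕜 := ℝ) (p := (y₀, (0 : ℝ)))))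
    refine h4.congr_fderiv ?_
    ext w <;> simp [normalMapDeriv, hfd y₀ hgrad0]
  set e := hΦ.toOpenPartialHomeomorph Φ hΦd (by norm_num) with he
  have hes : (y₀, (0 : ℝ)) ∈ e.source := hΦ.mem_toOpenPartialHomeomorph_source hΦd (by norm_num)
  have heΦ : ∀ p, e p = Φ p := fun p => rfl
  have hinv : ContDiffAt ℝ 2 e.symm (y₀, 0) := by
    have := hΦ.to_localInverse hΦd (by norm_num)
    rw [hΦ0] at this
    exact this
  set G : EuclideanSpace ℝ (Fin (n + 1)) → EuclideanSpace ℝ (Fin (n + 1)) × ℝ :=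
    fun x => e.symm (x, 0) with hGdef
  have hG : ContDiffAt ℝ 2 G y₀ :=
    ContDiffAt.comp y₀ (g := e.symm) hinv (contDiffAt_id.prodMk contDiffAt_const)
  have hcp := tendsto_closestPoint hM.isCompact hy₀
  have hnear : ∀ᶠ x in 𝓝 y₀, x = closestPoint M x +
      inner ℝ (ν (closestPoint M x)) (x - closestPoint M x) • ν (closestPoint M x) := by
    filter_upwards [hcp.eventually hgne, hcp.eventually (hU.mem_nhds hyU)] with x hx hxU
    have hspec := closestPoint_spec hM.isCompact hne x
    rw [← sub_eq_inner_smul_of_isLocalMinOn (norm_ne_zero_iff.2 hx) (hν1 _ hx)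
      (F := F) (x := x) (y := closestPoint M x)]
    · abel
    · rw [← hfd _ hx]
      exact (hFat _ hxU).hasStrictFDerivAt (by norm_num)
    -- The level set of F through cp x is locally M, so minimality on M is minimality on the level
    -- set.
    · have : ∀ᶠ z in 𝓝[{z | F z = F (closestPoint M x)}] (closestPoint M x), z ∈ M := by
        filter_upwards [self_mem_nhdsWithin,
          mem_nhdsWithin_of_mem_nhds (hU.mem_nhds hxU)] with z hz hzU
        have : z ∈ {z ∈ U | F z = 0} := ⟨hzU, by rw [hz, hFM _ hxU hspec.1]⟩
        rw [← hMU] at this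
        exact this.1
      filter_upwards [this] with z hz using hspec.2 hz
  -- Continuity of the candidate preimage places it in the source of `e`, where the inverse may be
  -- cancelled.
  have hs_tendsto : Tendsto (fun x => (closestPoint M x,
      inner ℝ (ν (closestPoint M x)) (x - closestPoint M x))) (𝓝 y₀) (𝓝 (y₀, 0)) := by
    refine hcp.prodMk_nhds ?_
    have h1 : Tendsto (fun x => ν (closestPoint M x)) (𝓝 y₀) (𝓝 (ν y₀)) :=
      hν.continuousAt.tendsto.comp hcp
    have h2 : Tendsto (fun x => x - closestPoint M x) (𝓝 y₀) (𝓝 (y₀ - y₀)) :=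
      tendsto_id.sub hcp
    have := h1.inner (𝕜 := ℝ) h2
    simpa using this
  have hGeq : ∀ᶠ x in 𝓝 y₀, G x = (closestPoint M x,
      inner ℝ (ν (closestPoint M x)) (x - closestPoint M x)) := by
    filter_upwards [hnear, hs_tendsto.eventually (e.open_source.mem_nhds hes),
      hcp.eventually (hU.mem_nhds hyU)] with x hx hxs hxU
    have : e (closestPoint M x,
        inner ℝ (ν (closestPoint M x)) (x - closestPoint M x)) = (x, 0) := by
      rw [heΦ]
      simp only [hΦdef]
      rw [← hx, hFM _ hxU (closestPoint_mem hM.isCompact hne x)]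
    rw [hGdef]
    simp only
    rw [← this, e.left_inv hxs]
  have hG1 : ∀ᶠ x in 𝓝 y₀, closestPoint M x = (G x).1 := by
    filter_upwards [hGeq] with x hx
    rw [hx]
  have hcpC : ContDiffAt ℝ 2 (closestPoint M) y₀ :=
    (contDiffAt_fst.comp y₀ hG).congr_of_eventuallyEq hG1
  refine ⟨ν, fun x => (G x).2, hcpC, hν, contDiffAt_snd.comp y₀ hG,
    hgne.mono hν1, ?_, ?_, ?_⟩
  · filter_upwards [hnear, hGeq] with x hx hGx
    rw [hGx]
    exact hx
  -- F ∘ cp vanishes identically near y₀; the chain rule makes the range of D cp orthogonal to ∇F,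
  -- hence to ν.
  · have h1 : ∀ᶠ x in 𝓝 y₀, ContDiffAt ℝ 2 (closestPoint M) x :=
      hcpC.eventually (by norm_num)
    have h2 : ∀ᶠ x in 𝓝 y₀, F (closestPoint M x) = 0 := by
      filter_upwards [hcp.eventually (hU.mem_nhds hyU)] with x hxU
      exact hFM _ hxU (closestPoint_mem hM.isCompact hne x)
    filter_upwards [h1, h2.eventually_nhds, hcp.eventually hgne,
      hcp.eventually (hU.mem_nhds hyU)] with x hx1 hx2 hx3 hxU h
    have hd : HasFDerivAt (fun z => F (closestPoint M z))
        (fderiv ℝ F (closestPoint M x) ∘L fderiv ℝ (closestPoint M) x) x :=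
      ((hFat _ hxU).differentiableAt (by norm_num)).hasFDerivAt.comp x
        (hx1.differentiableAt (by norm_num)).hasFDerivAt
    have hd0 : HasFDerivAt (fun z => F (closestPoint M z))
        (0 : EuclideanSpace ℝ (Fin (n + 1)) →L[ℝ] ℝ) x :=
      (hasFDerivAt_const (0 : ℝ) x).congr_of_eventuallyEq hx2
    have h0 := congrArg (fun l : EuclideanSpace ℝ (Fin (n + 1)) →L[ℝ] ℝ => l h)
      (hd.unique hd0)
    simp only [ContinuousLinearMap.comp_apply, hfd _ hx3] at h0
    simpa [hx3] using h0
  · have ht : Tendsto (fun p : EuclideanSpace ℝ (Fin (n + 1)) × ℝ => p.1 + p.2 • ν p.1)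
        (𝓝 (y₀, 0)) (𝓝 y₀) := by
      have : ContinuousAt (fun p : EuclideanSpace ℝ (Fin (n + 1)) × ℝ => p.1 + p.2 • ν p.1)
          (y₀, 0) := (contDiffAt_fst.add (contDiffAt_snd.smul hν')).continuousAt
      simpa [ContinuousAt] using this
    have hU' : ∀ᶠ p : EuclideanSpace ℝ (Fin (n + 1)) × ℝ in 𝓝 (y₀, 0), p.1 ∈ U :=
      continuousAt_fst.eventually (hU.mem_nhds hyU)
    filter_upwards [ht.eventually hG1, e.open_source.mem_nhds hes, hU'] with p hp1 hps hpU hpM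
    have hGp : G (p.1 + p.2 • ν p.1) = p := by
      have : (p.1 + p.2 • ν p.1, (0 : ℝ)) = e p := by
        rw [heΦ]
        simp only [hΦdef, hFM _ hpU hpM]
      rw [hGdef]
      simp only
      rw [this, e.left_inv hps]
    exact ⟨by rw [hp1, hGp], by rw [hGp]⟩

end ClosestPoint

/-! ### First-order geometry at a point of M -/

namespace IsNormalCoordinates

variable {n : ℕ} {M : Set (EuclideanSpace ℝ (Fin (n + 1)))}
  {y₀ : EuclideanSpace ℝ (Fin (n + 1))}
  {ν : EuclideanSpace ℝ (Fin (n + 1)) → EuclideanSpace ℝ (Fin (n + 1))}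
  {s : EuclideanSpace ℝ (Fin (n + 1)) → ℝ}

lemma norm_normal_self (h : IsNormalCoordinates M y₀ ν s) : ‖ν y₀‖ = 1 :=
  h.norm_normal.self_of_nhds

lemma dist_eq_zero (h : IsNormalCoordinates M y₀ ν s) : ∀ᶠ x in 𝓝 y₀, x ∈ M → s x = 0 := by
  have : Tendsto (fun x : EuclideanSpace ℝ (Fin (n + 1)) => (x, (0 : ℝ))) (𝓝 y₀)
      (𝓝 (y₀, 0)) := Continuous.tendsto (by fun_prop) y₀
  filter_upwards [this.eventually h.inverse] with x hx hxM
  simpa using (hx hxM).2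

lemma abs_dist (h : IsNormalCoordinates M y₀ ν s) (hM : IsCompact M) (hy₀ : y₀ ∈ M) :
    ∀ᶠ x in 𝓝 y₀, |s x| = ‖x - closestPoint M x‖ := by
  filter_upwards [h.decomp, (tendsto_closestPoint hM hy₀).eventually h.norm_normal] with x hx h1
  have : x - closestPoint M x = s x • ν (closestPoint M x) := by
    rw [sub_eq_iff_eq_add']; exact hx
  rw [this, norm_smul, h1, mul_one, Real.norm_eq_abs]

/-- Differentiate x = cp x + s(x) ν(cp x) at y₀; the term with Dν carries the factor s(y₀) = 0. -/
lemma fderiv_add (h : IsNormalCoordinates M y₀ ν s) (hM : IsCompact M) (hy₀ : y₀ ∈ M)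
    (u : EuclideanSpace ℝ (Fin (n + 1))) :
    u = fderiv ℝ (closestPoint M) y₀ u + fderiv ℝ s y₀ u • ν y₀ := by
  have hcp := closestPoint_of_mem hM hy₀
  have h1 := (h.contDiffAt_closestPoint.differentiableAt (by norm_num)).hasFDerivAt
  have h2 := (h.contDiffAt_dist.differentiableAt (by norm_num)).hasFDerivAt
  have h3 : HasFDerivAt ν (fderiv ℝ ν y₀) (closestPoint M y₀) := by
    rw [hcp]
    exact (h.contDiffAt_normal.differentiableAt (by norm_num)).hasFDerivAt
  have h4 := h1.add (h2.smul (h3.comp y₀ h1))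
  have h5 : HasFDerivAt (fun x => x) _ y₀ := h4.congr_of_eventuallyEq h.decomp
  have h6 := congrArg (fun l : EuclideanSpace ℝ (Fin (n + 1)) →L[ℝ] _ => l u)
    ((hasFDerivAt_id y₀).unique h5)
  simpa [h.dist_eq_zero.self_of_nhds hy₀, hcp] using h6

lemma inner_normal_fderiv (h : IsNormalCoordinates M y₀ ν s) (hM : IsCompact M) (hy₀ : y₀ ∈ M)
    (u : EuclideanSpace ℝ (Fin (n + 1))) :
    inner ℝ (ν y₀) (fderiv ℝ (closestPoint M) y₀ u) = 0 := by
  have := h.inner_fderiv.self_of_nhds u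
  rwa [closestPoint_of_mem hM hy₀] at this

lemma fderiv_dist (h : IsNormalCoordinates M y₀ ν s) (hM : IsCompact M) (hy₀ : y₀ ∈ M)
    (u : EuclideanSpace ℝ (Fin (n + 1))) : fderiv ℝ s y₀ u = inner ℝ (ν y₀) u := by
  conv_rhs => rw [h.fderiv_add hM hy₀ u]
  rw [inner_add_right, h.inner_normal_fderiv hM hy₀, inner_smul_right,
    real_inner_self_eq_norm_sq, h.norm_normal_self]
  ring

lemma fderiv_closestPoint (h : IsNormalCoordinates M y₀ ν s) (hM : IsCompact M) (hy₀ : y₀ ∈ M) :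
    fderiv ℝ (closestPoint M) y₀ = (ℝ ∙ ν y₀)ᗮ.starProjection := by
  ext1 u
  refine (Submodule.eq_starProjection_of_mem_orthogonal' (z := fderiv ℝ s y₀ u • ν y₀)
    ?_ ?_ (h.fderiv_add hM hy₀ u)).symm
  · exact Submodule.mem_orthogonal_singleton_iff_inner_right.2 (h.inner_normal_fderiv hM hy₀ u)
  · rw [Submodule.orthogonal_orthogonal]
    exact Submodule.smul_mem _ _ (Submodule.mem_span_singleton_self _)

/-- Tangent vectors are killed by Ds = ⟨ν, ·⟩ because s vanishes on M. Conversely cp maps the whole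
space into M, so its derivative, the projection onto the complement of ν, takes values in the
tangent cone. -/
lemma tangentSpaceAt_eq (h : IsNormalCoordinates M y₀ ν s) (hM : IsCompact M) (hy₀ : y₀ ∈ M) :
    tangentSpaceAt M y₀ = (ℝ ∙ ν y₀)ᗮ := by
  apply le_antisymm
  · refine Submodule.span_le.2 fun u hu => ?_
    rw [SetLike.mem_coe, Submodule.mem_orthogonal_singleton_iff_inner_right,
      ← h.fderiv_dist hM hy₀]
    obtain ⟨V, hV, hVM⟩ := eventually_iff_exists_mem.1 h.dist_eq_zero
    rw [← tangentConeAt_inter_nhds hV] at hu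
    have h1 : HasFDerivWithinAt s (fderiv ℝ s y₀) (M ∩ V) y₀ :=
      (h.contDiffAt_dist.differentiableAt (by norm_num)).hasFDerivAt.hasFDerivWithinAt
    have h2 := h1.mapsTo_tangent_cone hu
    have h3 : s '' (M ∩ V) ⊆ {0} := by
      rintro _ ⟨z, hz, rfl⟩
      exact hVM z hz.2 hz.1
    -- The image of M under s is locally a single point, whose tangent cone contains only 0.
    have h4 : ¬ AccPt (s y₀) (𝓟 (s '' (M ∩ V))) := fun hacc => by
      have h5 := hacc.mono (principal_mono.2 h3)
      rw [h.dist_eq_zero.self_of_nhds hy₀, accPt_principal_iff_nhdsWithin, sdiff_self] at h5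
      simp only [nhdsWithin_empty] at h5
      exact h5.ne rfl
    exact tangentConeAt_subset_zero h4 h2
  · intro u hu
    apply Submodule.subset_span
    have h1 : HasFDerivWithinAt (closestPoint M) (fderiv ℝ (closestPoint M) y₀) univ y₀ :=
      (h.contDiffAt_closestPoint.differentiableAt (by norm_num)).hasFDerivAt.hasFDerivWithinAt
    have h2 := h1.mapsTo_tangent_cone (show u ∈ tangentConeAt ℝ univ y₀ by simp)
    rw [h.fderiv_closestPoint hM hy₀, Submodule.starProjection_eq_self_iff.2 hu,
      closestPoint_of_mem hM hy₀] at h2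
    refine tangentConeAt_mono ?_ h2
    rintro _ ⟨z, -, rfl⟩
    exact closestPoint_mem hM ⟨y₀, hy₀⟩ z

end IsNormalCoordinates

/-! ### Coordinate-free consequences -/

namespace IsClosedHypersurface

variable {n : ℕ} {M : Set (EuclideanSpace ℝ (Fin (n + 1)))}

lemma contDiffAt_closestPoint (hM : IsClosedHypersurface 3 M)
    {y : EuclideanSpace ℝ (Fin (n + 1))} (hy : y ∈ M) : ContDiffAt ℝ 2 (closestPoint M) y :=
  let ⟨_, _, h⟩ := hM.exists_isNormalCoordinates hy
  h.contDiffAt_closestPoint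

lemma fderiv_closestPoint (hM : IsClosedHypersurface 3 M)
    {y : EuclideanSpace ℝ (Fin (n + 1))} (hy : y ∈ M) :
    fderiv ℝ (closestPoint M) y = tangentProj M y := by
  obtain ⟨ν, s, h⟩ := hM.exists_isNormalCoordinates hy
  simp only [h.fderiv_closestPoint hM.isCompact hy, tangentProj,
    h.tangentSpaceAt_eq hM.isCompact hy]

/-- Near `M` the vector from the closest point is normal to `M`, and the closest point map has
tangential derivative. -/
lemma eventually_inner_sub_closestPoint (hM : IsClosedHypersurface 3 M)
    {y : EuclideanSpace ℝ (Fin (n + 1))} (hy : y ∈ M) : ∀ᶠ x in 𝓝 y,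
    (∀ u ∈ tangentSpaceAt M (closestPoint M x), inner ℝ (x - closestPoint M x) u = 0) ∧
    ∀ u, inner ℝ (x - closestPoint M x) (fderiv ℝ (closestPoint M) x u) = 0 := by
  obtain ⟨ν, s, h⟩ := hM.exists_isNormalCoordinates hy
  have hcp := tendsto_closestPoint hM.isCompact hy
  filter_upwards [h.decomp, h.inner_fderiv, hcp.eventually h.inner_fderiv] with x hx h1 h2
  have hmem := closestPoint_mem hM.isCompact ⟨y, hy⟩ x
  have hsub : x - closestPoint M x = s x • ν (closestPoint M x) := by
    rw [sub_eq_iff_eq_add']; exact hx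
  rw [hsub]
  refine ⟨fun u hu => ?_, fun u => by rw [inner_smul_left, h1, mul_zero]⟩
  have := h2 u
  rw [hM.fderiv_closestPoint hmem, tangentProj, Submodule.starProjection_eq_self_iff.2 hu,
    closestPoint_of_mem hM.isCompact hmem] at this
  rw [inner_smul_left, this, mul_zero]

end IsClosedHypersurface

/-! ### Hausdorff measure under near-isometries, and volumes of cylinders -/

section Measure

/-- A map that distorts distances by a factor at most `K` distorts the `d`-dimensional measure by
a factor at most `K ^ d`. -/
lemma euclideanHausdorffMeasure_image_le_of_lipschitzOnWith {X Y : Type*}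
    [EMetricSpace X] [MeasurableSpace X] [BorelSpace X]
    [EMetricSpace Y] [MeasurableSpace Y] [BorelSpace Y] {f : X → Y} {S : Set X} {K : NNReal}
    (hf : LipschitzOnWith K f S) (d : ℕ) : μHE[d] (f '' S) ≤ (K : ENNReal) ^ d * μHE[d] S := by
  rw [Measure.euclideanHausdorffMeasure_def, Measure.euclideanHausdorffMeasure_def,
    Measure.smul_apply, Measure.smul_apply, ENNReal.smul_def, ENNReal.smul_def, smul_eq_mul,
    smul_eq_mul, mul_left_comm]
  gcongr
  simpa using hf.hausdorffMeasure_image_le (d := d) (by positivity)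

lemma euclideanHausdorffMeasure_le_of_dist_le {X Y : Type*}
    [MetricSpace X] [MeasurableSpace X] [BorelSpace X]
    [MetricSpace Y] [MeasurableSpace Y] [BorelSpace Y] {f : X → Y} {S : Set X} {K : NNReal}
    (hf : ∀ x ∈ S, ∀ y ∈ S, dist x y ≤ K * dist (f x) (f y)) (d : ℕ) :
    μHE[d] S ≤ (K : ENNReal) ^ d * μHE[d] (f '' S) := by
  rcases S.eq_empty_or_nonempty with rfl | ⟨x₀, -⟩
  · simp
  have : Nonempty X := ⟨x₀⟩
  have hinj : InjOn f S := fun x hx y hy hxy => by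
    have := hf x hx y hy
    rw [hxy, dist_self, mul_zero] at this
    exact dist_le_zero.1 this
  have hL : LipschitzOnWith K (Function.invFunOn f S) (f '' S) := by
    refine LipschitzOnWith.of_dist_le_mul ?_
    rintro _ ⟨x, hx, rfl⟩ _ ⟨y, hy, rfl⟩
    rw [hinj.leftInvOn_invFunOn hx, hinj.leftInvOn_invFunOn hy]
    exact hf x hx y hy
  have := euclideanHausdorffMeasure_image_le_of_lipschitzOnWith hL d
  rwa [hinj.leftInvOn_invFunOn.image_image] at this

/-- The volume of a right cylinder. -/
lemma volume_image_add_smul {n : ℕ} {ν : EuclideanSpace ℝ (Fin (n + 1))} (hν : ‖ν‖ = 1)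
    {B : Set (EuclideanSpace ℝ (Fin (n + 1)))} (hB : B ⊆ (ℝ ∙ ν)ᗮ) (ε : ℝ) :
    volume {x | ∃ k ∈ B, ∃ r : ℝ, |r| < ε ∧ x = k + r • ν} =
      ENNReal.ofReal (2 * ε) * μHE[n] B := by
  have hν0 : ν ≠ 0 := by rintro rfl; simp at hν
  have hmp := (ℝ ∙ ν).measurePreserving_measurableEquivProd (0 : EuclideanSpace ℝ (Fin (n + 1)))
  set e := (ℝ ∙ ν).measurableEquivProd (0 : EuclideanSpace ℝ (Fin (n + 1))) with he
  rw [InnerProductSpace.euclideanHausdorffMeasure_eq_volume] at hmp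
  set B' : Set (ℝ ∙ ν)ᗮ := Subtype.val ⁻¹' B with hB'
  have hBB' : Subtype.val '' B' = B := by
    refine Set.Subset.antisymm (Set.image_preimage_subset _ _) fun x hx => ?_
    exact ⟨⟨x, hB hx⟩, hx, rfl⟩
  have hrank : Module.finrank ℝ (ℝ ∙ ν)ᗮ = n := by
    have : Fact (Module.finrank ℝ (EuclideanSpace ℝ (Fin (n + 1))) = n + 1) := ⟨by simp⟩
    exact Submodule.finrank_orthogonal_span_singleton hν0
  let L := LinearIsometryEquiv.toSpanUnitSingleton (𝕜 := ℝ) ν hν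
  set I : Set (ℝ ∙ ν) := L '' {r : ℝ | |r| < ε} with hI
  have hvI : volume I = ENNReal.ofReal (2 * ε) := by
    have hIoo : {r : ℝ | |r| < ε} = Ioo (-ε) ε := by ext r; simp [abs_lt]
    have himg : I = L.symm ⁻¹' {r : ℝ | |r| < ε} := L.toEquiv.image_eq_preimage_symm _
    rw [himg, hIoo, L.symm.measurePreserving.measure_preimage measurableSet_Ioo.nullMeasurableSet,
      Real.volume_Ioo]
    congr 1
    ring
  have hvB : volume B' = μHE[n] B := by
    rw [← InnerProductSpace.euclideanHausdorffMeasure_eq_volume, hrank, ← hBB',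
      isometry_subtype_coe.euclideanHausdorffMeasure_image]
  have hset : {x | ∃ k ∈ B, ∃ r : ℝ, |r| < ε ∧ x = k + r • ν} = e ⁻¹' (I ×ˢ B') := by
    ext x
    constructor
    · rintro ⟨k, hk, r, hr, rfl⟩
      have : k + r • ν = e.symm (L r, ⟨k, hB hk⟩) := by
        rw [he, Submodule.measurableEquivProd_symm_apply]
        simp [L, add_comm]
      rw [mem_preimage, this, e.apply_symm_apply]
      exact ⟨⟨r, hr, rfl⟩, hk⟩
    · rintro ⟨⟨r, hr, hr'⟩, hk⟩
      refine ⟨_, hk, r, hr, ?_⟩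
      have hx : x = e.symm (e x) := (e.symm_apply_apply x).symm
      conv_lhs => rw [hx, he, Submodule.measurableEquivProd_symm_apply, ← he, ← hr']
      simp [L, add_comm]
  rw [hset, hmp.measure_preimage_equiv, Measure.volume_eq_prod, Measure.prod_prod, hvI, hvB]

end Measure

/-- A map whose strict derivative at `a` is the identity is nearly isometric near `a`. -/
lemma HasStrictFDerivAt.exists_dist_le_of_id {E : Type*} [NormedAddCommGroup E] [NormedSpace ℝ E]
    {f : E → E} {a : E} (hf : HasStrictFDerivAt f (ContinuousLinearMap.id ℝ E) a)
    {K : NNReal} (hK : 1 < K) :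
    ∃ V ∈ 𝓝 a, ∀ x ∈ V, ∀ z ∈ V,
      dist (f x) (f z) ≤ K * dist x z ∧ dist x z ≤ K * dist (f x) (f z) := by
  have hK' : (1 : ℝ) < K := hK
  have hc : (0 : ℝ) < 1 - (K : ℝ)⁻¹ := sub_pos.2 (inv_lt_one_of_one_lt₀ hK')
  -- With c = 1 - 1/K the lower bound 1 - c is exactly 1/K, and the upper bound 1 + c = 2 - 1/K is
  -- at most K.
  obtain ⟨V, hV, h⟩ := hf.approximates_deriv_on_nhds (c := ⟨1 - (K : ℝ)⁻¹, hc.le⟩) (Or.inr hc)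
  refine ⟨V, hV, fun x hx z hz => ?_⟩
  have h1 : ‖f x - f z - (x - z)‖ ≤ (1 - (K : ℝ)⁻¹) * ‖x - z‖ := h x hx z hz
  have h2 := norm_sub_norm_le (f x - f z) (x - z)
  have h3 := norm_sub_norm_le (x - z) (f x - f z)
  rw [norm_sub_rev (x - z) (f x - f z)] at h3
  rw [dist_eq_norm, dist_eq_norm]
  have hinv : (K : ℝ) * (K : ℝ)⁻¹ = 1 := mul_inv_cancel₀ (by positivity)
  have hKK : 2 - (K : ℝ)⁻¹ ≤ K := by nlinarith [inv_pos.2 (zero_lt_one.trans hK')]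
  constructor
  · nlinarith [norm_nonneg (x - z)]
  · have h4 : (K : ℝ)⁻¹ * ‖x - z‖ ≤ ‖f x - f z‖ := by linarith
    calc ‖x - z‖ = K * ((K : ℝ)⁻¹ * ‖x - z‖) := by rw [← mul_assoc, hinv, one_mul]
      _ ≤ K * ‖f x - f z‖ := by gcongr

/-! ### Volumes of tubes compared with surface measure -/

section Tube

variable {n : ℕ} {M : Set (EuclideanSpace ℝ (Fin (n + 1)))}

lemma mem_thickening_iff_norm_sub_closestPoint (hM : IsCompact M) (hne : M.Nonempty) {ε : ℝ}
    {x : EuclideanSpace ℝ (Fin (n + 1))} :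
    x ∈ thickening ε M ↔ ‖x - closestPoint M x‖ < ε := by
  rw [norm_sub_closestPoint hM hne, mem_thickening_iff_infDist_lt hne]

/-- The tube over a small piece `B` of `M` has volume close to that of a right cylinder. -/
lemma IsNormalCoordinates.exists_volume_tube_le
    {y₀ : EuclideanSpace ℝ (Fin (n + 1))}
    {ν : EuclideanSpace ℝ (Fin (n + 1)) → EuclideanSpace ℝ (Fin (n + 1))}
    {s : EuclideanSpace ℝ (Fin (n + 1)) → ℝ}
    (h : IsNormalCoordinates M y₀ ν s) (hM : IsCompact M) (hy₀ : y₀ ∈ M) {K : NNReal}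
    (hK : 1 < K) :
    ∃ r > 0, ∀ ε < r, ∀ B ⊆ M ∩ ball y₀ r,
      volume (thickening ε M ∩ closestPoint M ⁻¹' B) ≤
        (K : ENNReal) ^ (2 * n + 1) * (ENNReal.ofReal (2 * ε) * μHE[n] B) ∧
      ENNReal.ofReal (2 * ε) * μHE[n] B ≤
        (K : ENNReal) ^ (2 * n + 1) * volume (thickening ε M ∩ closestPoint M ⁻¹' B) := by
  have hne : M.Nonempty := ⟨y₀, hy₀⟩
  set π := (ℝ ∙ ν y₀)ᗮ.starProjection with hπ
  -- Θ straightens the tube: M goes to the tangent plane and normals become parallel to ν y₀. Its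
  -- derivative at y₀ is the identity.
  set Θ : EuclideanSpace ℝ (Fin (n + 1)) → EuclideanSpace ℝ (Fin (n + 1)) :=
    fun x => π (closestPoint M x) + s x • ν y₀ with hΘ
  have hΘd : HasStrictFDerivAt Θ (ContinuousLinearMap.id ℝ _) y₀ := by
    have h1 := π.hasStrictFDerivAt.comp y₀
      (h.contDiffAt_closestPoint.hasStrictFDerivAt (by norm_num))
    have h2 := (h.contDiffAt_dist.hasStrictFDerivAt (by norm_num)).smul_const (ν y₀)
    refine (h1.add h2).congr_fderiv ?_
    ext1 u
    have h3 := h.fderiv_add hM hy₀ u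
    have h4 : π (fderiv ℝ (closestPoint M) y₀ u) = fderiv ℝ (closestPoint M) y₀ u :=
      Submodule.starProjection_eq_self_iff.2
        (Submodule.mem_orthogonal_singleton_iff_inner_right.2 (h.inner_normal_fderiv hM hy₀ u))
    simp only [add_apply, ContinuousLinearMap.comp_apply,
      ContinuousLinearMap.smulRight_apply, ContinuousLinearMap.id_apply]
    rw [h4]
    exact h3.symm
  obtain ⟨V, hV, hVΘ⟩ := hΘd.exists_dist_le_of_id hK
  obtain ⟨r₁, hr₁, hball₁⟩ := Metric.eventually_nhds_iff_ball.1
    ((eventually_mem_set.2 hV).and ((h.abs_dist hM hy₀).and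
      (h.dist_eq_zero.and h.norm_normal)))
  obtain ⟨r₂, hr₂, hball₂⟩ := Metric.eventually_nhds_iff_ball.1 h.inverse
  -- Half of r₁ bounds B and half the tube radius, so the tube over B stays in the ball of radius
  -- r₁; r₂ serves the inverse map.
  refine ⟨min (r₁ / 2) r₂, by positivity, fun ε hεr B hB => ?_⟩
  have hBM : B ⊆ M := fun y hy => (hB hy).1
  have hB₁ : ∀ y ∈ B, y ∈ ball y₀ (r₁ / 2) := fun y hy =>
    ball_subset_ball (min_le_left _ _) (hB hy).2
  have hB₁' : ∀ y ∈ B, y ∈ ball y₀ r₁ := fun y hy =>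
    ball_subset_ball (by linarith) (hB₁ y hy)
  have hεr₁ : ε < r₁ / 2 := hεr.trans_le (min_le_left _ _)
  have hεr₂ : ε < r₂ := hεr.trans_le (min_le_right _ _)
  set S := thickening ε M ∩ closestPoint M ⁻¹' B with hS
  have hSx : ∀ x ∈ S, x ∈ ball y₀ r₁ := by
    rintro x ⟨hx1, hx2⟩
    rw [mem_thickening_iff_norm_sub_closestPoint hM hne, ← dist_eq_norm] at hx1
    have := hB₁ _ hx2
    rw [mem_ball] at this ⊢
    linarith [dist_triangle x (closestPoint M x) y₀]
  have hΘM : ∀ y ∈ B, Θ y = π y := fun y hy => by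
    simp only [hΘ]
    rw [(hball₁ y (hB₁' y hy)).2.2.1 (hBM hy), closestPoint_of_mem hM (hBM hy)]
    simp
  have hΘB : Θ '' B ⊆ (ℝ ∙ ν y₀)ᗮ := by
    rintro _ ⟨y, hy, rfl⟩
    rw [hΘM y hy]
    exact Submodule.starProjection_apply_mem _ _
  have hΘS : Θ '' S = {x | ∃ k ∈ Θ '' B, ∃ r : ℝ, |r| < ε ∧ x = k + r • ν y₀} := by
    ext z
    constructor
    · rintro ⟨x, hx, rfl⟩
      refine ⟨_, ⟨closestPoint M x, hx.2, rfl⟩, s x, ?_, ?_⟩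
      · rw [(hball₁ x (hSx x hx)).2.1]
        exact (mem_thickening_iff_norm_sub_closestPoint hM hne).1 hx.1
      · rw [hΘM _ hx.2]
    · rintro ⟨_, ⟨y, hy, rfl⟩, r, hr, rfl⟩
      have hp : (y, r) ∈ ball (y₀, (0 : ℝ)) r₂ := by
        rw [mem_ball, Prod.dist_eq]
        refine max_lt (ball_subset_ball (min_le_right _ _) (hB hy).2) ?_
        simpa [Real.dist_eq] using hr.trans hεr₂
      obtain ⟨h1, h2⟩ := hball₂ _ hp (hBM hy)
      simp only at h1 h2
      refine ⟨y + r • ν y, ⟨?_, ?_⟩, ?_⟩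
      · rw [mem_thickening_iff]
        refine ⟨y, hBM hy, ?_⟩
        rw [dist_eq_norm, add_sub_cancel_left, norm_smul, (hball₁ y (hB₁' y hy)).2.2.2, mul_one]
        exact hr
      · rw [mem_preimage, h1]
        exact hy
      · rw [hΘM y hy]
        simp only [hΘ]
        rw [h1, h2]
  have hvol : volume (Θ '' S) = ENNReal.ofReal (2 * ε) * μHE[n] (Θ '' B) := by
    rw [hΘS, volume_image_add_smul h.norm_normal_self hΘB]
  have hLip : ∀ A : Set (EuclideanSpace ℝ (Fin (n + 1))), (∀ x ∈ A, x ∈ ball y₀ r₁) →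
      ∀ d : ℕ, μHE[d] (Θ '' A) ≤ (K : ENNReal) ^ d * μHE[d] A ∧
        μHE[d] A ≤ (K : ENNReal) ^ d * μHE[d] (Θ '' A) := fun A hA d =>
    ⟨euclideanHausdorffMeasure_image_le_of_lipschitzOnWith (LipschitzOnWith.of_dist_le_mul
      fun x hx z hz => (hVΘ x (hball₁ x (hA x hx)).1 z (hball₁ z (hA z hz)).1).1) d,
    euclideanHausdorffMeasure_le_of_dist_le
      (fun x hx z hz => (hVΘ x (hball₁ x (hA x hx)).1 z (hball₁ z (hA z hz)).1).2) d⟩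
  -- The distortion is K^(n+1) for the solid tube and K^n for its base, together K^(2n+1).
  obtain ⟨hS1, hS2⟩ := hLip S hSx (n + 1)
  obtain ⟨hB1, hB2⟩ := hLip B hB₁' n
  rw [EuclideanSpace.euclideanHausdorffMeasure_eq_volume] at hS1 hS2
  constructor
  · calc volume S ≤ (K : ENNReal) ^ (n + 1) * volume (Θ '' S) := hS2
      _ ≤ (K : ENNReal) ^ (n + 1) * (ENNReal.ofReal (2 * ε) * ((K : ENNReal) ^ n * μHE[n] B)) := by
        rw [hvol]; gcongr
      _ = _ := by ring
  · calc ENNReal.ofReal (2 * ε) * μHE[n] B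
        ≤ ENNReal.ofReal (2 * ε) * ((K : ENNReal) ^ n * μHE[n] (Θ '' B)) := by gcongr
      _ = (K : ENNReal) ^ n * volume (Θ '' S) := by rw [hvol]; ring
      _ ≤ (K : ENNReal) ^ n * ((K : ENNReal) ^ (n + 1) * volume S) := by gcongr
      _ = _ := by ring

/-- An inequality between measures that holds on small pieces of `M` holds on `M`. -/
lemma measure_le_of_forall_subset_biUnion {X ι : Type*} [MeasurableSpace X] {μ₁ μ₂ : Measure X}
    {N : Set X} {W : ι → Set X} (hW : ∀ i, MeasurableSet (W i)) (t : Finset ι)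
    (h : ∀ i ∈ t, ∀ B, MeasurableSet B → B ⊆ N ∩ W i → μ₁ B ≤ μ₂ B) :
    ∀ B, MeasurableSet B → B ⊆ N → B ⊆ ⋃ i ∈ t, W i → μ₁ B ≤ μ₂ B := by
  classical
  induction t using Finset.induction_on with
  | empty =>
    intro B _ _ hBt
    have : B = ∅ := by simpa using hBt
    simp [this]
  | insert i t hi ih =>
    intro B hB hBN hBt
    rw [← measure_inter_add_sdiff B (hW i), ← measure_inter_add_sdiff (μ := μ₂) B (hW i)]
    refine add_le_add (h i (by simp) _ (hB.inter (hW i)) (inter_subset_inter_left _ hBN))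
      (ih (fun j hj => h j (by simp [hj])) _ (hB.diff (hW i)) (sdiff_subset.trans hBN) ?_)
    rintro x ⟨hx, hxi⟩
    have := hBt hx
    simp only [Finset.mem_insert, iUnion_iUnion_eq_or_left, mem_union] at this
    exact this.resolve_left hxi

/-- The normalization-free tubular measure: the image under the closest point map of Lebesgue
measure on the `ε`-neighbourhood of `M`. -/
noncomputable def tubeMeasure (M : Set (EuclideanSpace ℝ (Fin (n + 1)))) (ε : ℝ) :
    Measure (EuclideanSpace ℝ (Fin (n + 1))) :=
  (volume.restrict (thickening ε M)).map (closestPoint M)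

/-- Compactness turns pointwise neighbourhoods into a tube of uniform radius. -/
lemma IsClosedHypersurface.exists_thickening_subset (hM : IsClosedHypersurface 3 M)
    {p : EuclideanSpace ℝ (Fin (n + 1)) → Prop} (hp : ∀ y ∈ M, ∀ᶠ x in 𝓝 y, p x) :
    ∃ r > 0, ∀ x ∈ thickening r M, p x := by
  have : {x | p x} ∈ 𝓝ˢ M := mem_nhdsSet_iff_forall.2 hp
  obtain ⟨r, hr, h⟩ := (hasBasis_nhdsSet_thickening hM.isCompact).mem_iff.1 this
  exact ⟨r, hr, h⟩

lemma IsClosedHypersurface.exists_contDiffAt_closestPoint (hM : IsClosedHypersurface 3 M) :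
    ∃ r > 0, ∀ x ∈ thickening r M, ContDiffAt ℝ 2 (closestPoint M) x :=
  hM.exists_thickening_subset fun _ hy =>
    (hM.contDiffAt_closestPoint hy).eventually (by norm_num)

lemma IsClosedHypersurface.exists_aemeasurable_closestPoint (hM : IsClosedHypersurface 3 M) :
    ∃ r > 0, ∀ ε ≤ r,
      AEMeasurable (closestPoint M) (volume.restrict (thickening ε M)) := by
  obtain ⟨r, hr, h⟩ := hM.exists_contDiffAt_closestPoint
  refine ⟨r, hr, fun ε hε => ContinuousOn.aemeasurable (fun x hx => ?_)
    isOpen_thickening.measurableSet⟩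
  exact (h x (thickening_mono hε M hx)).continuousAt.continuousWithinAt

/-- The tubular measures are asymptotic to `2 * ε` times the surface measure. -/
lemma IsClosedHypersurface.exists_tubeMeasure_le (hM : IsClosedHypersurface 3 M)
    (hne : M.Nonempty) {κ : NNReal} (hκ : 1 < κ) :
    ∃ r > 0, ∀ ε < r,
      tubeMeasure M ε ≤ ((κ : ENNReal) * ENNReal.ofReal (2 * ε)) • surfaceMeasure M ∧
      ENNReal.ofReal (2 * ε) • surfaceMeasure M ≤ (κ : ENNReal) • tubeMeasure M ε := by
  obtain ⟨K, hK, hKκ⟩ : ∃ K : NNReal, 1 < K ∧ K ^ (2 * n + 1) ≤ κ := by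
    have hc : Tendsto (fun K : NNReal => K ^ (2 * n + 1)) (𝓝[>] 1) (𝓝 1) := by
      have : Continuous fun K : NNReal => K ^ (2 * n + 1) := by fun_prop
      simpa using (this.tendsto 1).mono_left nhdsWithin_le_nhds
    obtain ⟨K, h1, h2⟩ := ((hc.eventually_le_const hκ).and self_mem_nhdsWithin).exists
    exact ⟨K, h2, h1⟩
  have hloc : ∀ y : M, ∃ r > 0, ∀ ε < r, ∀ B ⊆ M ∩ ball (y : EuclideanSpace ℝ (Fin (n + 1))) r,
      volume (thickening ε M ∩ closestPoint M ⁻¹' B) ≤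
        (K : ENNReal) ^ (2 * n + 1) * (ENNReal.ofReal (2 * ε) * μHE[n] B) ∧
      ENNReal.ofReal (2 * ε) * μHE[n] B ≤
        (K : ENNReal) ^ (2 * n + 1) * volume (thickening ε M ∩ closestPoint M ⁻¹' B) := by
    intro y
    obtain ⟨ν, s, h⟩ := hM.exists_isNormalCoordinates y.2
    exact h.exists_volume_tube_le hM.isCompact y.2 hK
  choose ρ hρ hρB using hloc
  obtain ⟨t, ht⟩ := hM.isCompact.elim_finite_subcover
    (fun y : M => ball (y : EuclideanSpace ℝ (Fin (n + 1))) (ρ y)) (fun _ => isOpen_ball)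
    (fun y hy => mem_iUnion.2 ⟨⟨y, hy⟩, mem_ball_self (hρ _)⟩)
  obtain ⟨r₀, hr₀, hmeas⟩ := hM.exists_aemeasurable_closestPoint
  have hmin : ∃ r > 0, r ≤ r₀ ∧ ∀ y ∈ t, r ≤ ρ y := by
    clear ht
    induction t using Finset.induction_on with
    | empty => exact ⟨r₀, hr₀, le_rfl, by simp⟩
    | insert y t _ ih =>
      obtain ⟨r, hr, hr', h⟩ := ih
      refine ⟨min r (ρ y), lt_min hr (hρ y), (min_le_left _ _).trans hr', fun z hz => ?_⟩
      rcases Finset.mem_insert.1 hz with rfl | hz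
      · exact min_le_right _ _
      · exact (min_le_left _ _).trans (h z hz)
  obtain ⟨r, hr, hrr₀, hrt⟩ := hmin
  refine ⟨r, hr, fun ε hε => ?_⟩
  have hae := hmeas ε (hε.le.trans hrr₀)
  have hMm : MeasurableSet M := hM.isCompact.isClosed.measurableSet
  have htube : ∀ B, MeasurableSet B →
      tubeMeasure M ε B = volume (thickening ε M ∩ closestPoint M ⁻¹' B) := fun B hB => by
    rw [tubeMeasure, Measure.map_apply_of_aemeasurable hae hB,
      Measure.restrict_apply' isOpen_thickening.measurableSet, inter_comm]
  have hsurf : ∀ B, B ⊆ M → surfaceMeasure M B = μHE[n] B := fun B hBM => by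
    rw [surfaceMeasure, Measure.restrict_apply' hMm, inter_eq_left.2 hBM]
  have hKκ' : (K : ENNReal) ^ (2 * n + 1) ≤ κ := by exact_mod_cast hKκ
  have htM : tubeMeasure M ε Mᶜ = 0 := by
    rw [htube _ hMm.compl]
    have : thickening ε M ∩ closestPoint M ⁻¹' Mᶜ = ∅ := by
      ext x
      simp [closestPoint_mem hM.isCompact hne x]
    rw [this, measure_empty]
  have hsM : surfaceMeasure M Mᶜ = 0 := by
    rw [surfaceMeasure, Measure.restrict_apply' hMm, compl_inter_self, measure_empty]
  -- Both measures are concentrated on M, so it suffices to compare them on subsets of M, where the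
  -- finite cover applies.
  have hsplit : ∀ μ : Measure (EuclideanSpace ℝ (Fin (n + 1))), μ Mᶜ = 0 → ∀ B,
      μ B = μ (B ∩ M) := fun μ hμ B => by
    rw [← measure_inter_add_sdiff B hMm, measure_mono_null (fun x hx => hx.2 : B \ M ⊆ Mᶜ) hμ,
      add_zero]
  constructor
  · refine Measure.le_iff.2 fun B hB => ?_
    rw [hsplit _ htM B, hsplit (_ • surfaceMeasure M) (by simp [hsM]) B]
    refine measure_le_of_forall_subset_biUnion (N := M) (fun _ => measurableSet_ball) t
      (fun y hy C hC hCM => ?_) _ (hB.inter hMm) inter_subset_right (inter_subset_right.trans ht)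
    rw [htube C hC, Measure.smul_apply, hsurf C (hCM.trans inter_subset_left), smul_eq_mul,
      mul_assoc]
    refine ((hρB y ε (hε.trans_le (hrt y hy)) C hCM).1).trans ?_
    gcongr
  · refine Measure.le_iff.2 fun B hB => ?_
    rw [hsplit (_ • tubeMeasure M ε) (by simp [htM]) B,
      hsplit (_ • surfaceMeasure M) (by simp [hsM]) B]
    refine measure_le_of_forall_subset_biUnion (N := M) (fun _ => measurableSet_ball) t
      (fun y hy C hC hCM => ?_) _ (hB.inter hMm) inter_subset_right (inter_subset_right.trans ht)
    rw [Measure.smul_apply, Measure.smul_apply, htube C hC,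
      hsurf C (hCM.trans inter_subset_left), smul_eq_mul, smul_eq_mul]
    refine ((hρB y ε (hε.trans_le (hrt y hy)) C hCM).2).trans ?_
    gcongr

end Tube

/-! ### The divergence theorem in the ambient space -/

section Divergence

/-- The integral of a directional derivative of a compactly supported function vanishes. -/
lemma integral_fderiv_apply_eq_zero {E : Type*} [NormedAddCommGroup E] [NormedSpace ℝ E]
    [FiniteDimensional ℝ E] [MeasurableSpace E] [BorelSpace E] (μ : Measure E)
    [μ.IsAddHaarMeasure] {g : E → ℝ} (hg : ContDiff ℝ 1 g) (hgc : HasCompactSupport g) (u : E) :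
    ∫ x, fderiv ℝ g x u ∂μ = 0 := by
  have hcont : Continuous fun x => fderiv ℝ g x u :=
    (hg.continuous_fderiv (by norm_num)).clm_apply continuous_const
  have hint : Integrable (fun x => fderiv ℝ g x u) μ :=
    hcont.integrable_of_hasCompactSupport (hgc.fderiv_apply (𝕜 := ℝ) u)
  have := integral_mul_fderiv_eq_neg_fderiv_mul_of_integrable (μ := μ) (𝕜 := ℝ)
    (f := fun _ => (1 : ℝ)) (g := g) (v := u) (by simp) (by simpa using hint)
    (by simpa using hg.continuous.integrable_of_hasCompactSupport hgc)
    (fun x _ => differentiableAt_const _)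
    (fun x _ => hg.differentiable (by norm_num) x)
  simpa using this

lemma integral_trace_fderiv_eq_zero {m : ℕ}
    {Y : EuclideanSpace ℝ (Fin m) → EuclideanSpace ℝ (Fin m)} (hY : ContDiff ℝ 1 Y)
    (hYc : HasCompactSupport Y) :
    ∫ x, LinearMap.trace ℝ _ (fderiv ℝ Y x).toLinearMap = 0 := by
  set b := EuclideanSpace.basisFun (Fin m) ℝ
  have htr : ∀ x, LinearMap.trace ℝ _ (fderiv ℝ Y x).toLinearMap =
      ∑ i, fderiv ℝ (fun z => inner ℝ (b i) (Y z)) x (b i) := fun x => by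
    rw [LinearMap.trace_eq_sum_inner _ b]
    refine Finset.sum_congr rfl fun i _ => ?_
    have := ((innerSL ℝ (b i)).hasFDerivAt (x := Y x)).comp x
      (hY.differentiable (by norm_num) x).hasFDerivAt
    have h2 : fderiv ℝ (fun z => inner ℝ (b i) (Y z)) x = innerSL ℝ (b i) ∘L fderiv ℝ Y x :=
      this.fderiv
    rw [h2]
    rfl
  have hC : ∀ i, ContDiff ℝ 1 fun z => inner ℝ (b i) (Y z) := fun i => contDiff_const.inner ℝ hY
  have hS : ∀ i, HasCompactSupport fun z => inner ℝ (b i) (Y z) := fun i =>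
    hYc.comp_left (g := fun z => inner ℝ (b i) z) (by simp)
  simp_rw [htr]
  rw [integral_finsetSum]
  · exact Finset.sum_eq_zero fun i _ => integral_fderiv_apply_eq_zero volume (hC i) (hS i) (b i)
  · intro i _
    exact (((hC i).continuous_fderiv (by norm_num)).clm_apply
      continuous_const).integrable_of_hasCompactSupport ((hS i).fderiv_apply (𝕜 := ℝ) (b i))

end Divergence

/-! ### No flux through the boundary of a tube -/

section Tube

variable {n : ℕ} {M : Set (EuclideanSpace ℝ (Fin (n + 1)))}

lemma continuousAt_trace_fderiv {m : ℕ}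
    {Z : EuclideanSpace ℝ (Fin m) → EuclideanSpace ℝ (Fin m)} {x : EuclideanSpace ℝ (Fin m)}
    (hZ : ContDiffAt ℝ 1 Z x) :
    ContinuousAt (fun z => LinearMap.trace ℝ _ (fderiv ℝ Z z).toLinearMap) x := by
  have h1 : ContinuousAt (fderiv ℝ Z) x :=
    (hZ.fderiv_right (m := 0) (by norm_num)).continuousAt
  have h2 : Continuous fun l : EuclideanSpace ℝ (Fin m) →L[ℝ] EuclideanSpace ℝ (Fin m) =>
      LinearMap.trace ℝ (EuclideanSpace ℝ (Fin m)) l.toLinearMap :=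
    LinearMap.continuous_of_finiteDimensional
      (LinearMap.trace ℝ (EuclideanSpace ℝ (Fin m)) ∘ₗ ContinuousLinearMap.coeLM ℝ)
  exact h2.continuousAt.comp h1

/-- A field tangential to the level sets of the distance to `M` has no flux through the boundary
of a tube around `M`. -/
lemma setIntegral_trace_fderiv_thickening_eq_zero (hM : IsCompact M) (hne : M.Nonempty) {r : ℝ}
    (hcp : ∀ x ∈ thickening r M, ContDiffAt ℝ 2 (closestPoint M) x)
    (hcpd : ∀ x ∈ thickening r M, ∀ u,
      inner ℝ (x - closestPoint M x) (fderiv ℝ (closestPoint M) x u) = 0)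
    {Z : EuclideanSpace ℝ (Fin (n + 1)) → EuclideanSpace ℝ (Fin (n + 1))}
    (hZ : ∀ x ∈ thickening r M, ContDiffAt ℝ 1 Z x)
    (hZn : ∀ x ∈ thickening r M, inner ℝ (x - closestPoint M x) (Z x) = 0)
    {ε : ℝ} (hε : 0 < ε) (hεr : ε < r) :
    ∫ x in thickening ε M, LinearMap.trace ℝ _ (fderiv ℝ Z x).toLinearMap = 0 := by
  -- The squared distance, unlike the distance, is differentiable on M as well. Tangentiality of D
  -- cp leaves 2 (x - cp x) as its gradient.
  set q : EuclideanSpace ℝ (Fin (n + 1)) → ℝ := fun x => ‖x - closestPoint M x‖ ^ 2 with hq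
  set τ : EuclideanSpace ℝ (Fin (n + 1)) → ℝ :=
    fun x => LinearMap.trace ℝ _ (fderiv ℝ Z x).toLinearMap with hτ
  have hmem : ∀ {ρ : ℝ} {x}, x ∈ thickening ρ M ↔ ‖x - closestPoint M x‖ < ρ := fun {_ _} =>
    mem_thickening_iff_norm_sub_closestPoint hM hne
  have hqlt : ∀ {x}, x ∈ thickening ε M ↔ q x < ε ^ 2 := fun {x} => by
    rw [hmem, hq]
    exact (sq_lt_sq₀ (norm_nonneg _) hε.le).symm
  have hqC : ∀ x ∈ thickening r M, ContDiffAt ℝ 1 q x := fun x hx =>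
    (contDiffAt_id.sub ((hcp x hx).of_le (by norm_num))).norm_sq ℝ
  have hqd : ∀ x ∈ thickening r M, HasFDerivAt q (2 • innerSL ℝ (x - closestPoint M x)) x := by
    intro x hx
    have h1 := (hasFDerivAt_id x).sub ((hcp x hx).differentiableAt (by norm_num)).hasFDerivAt
    have h2 : HasFDerivAt q _ x :=
      HasFDerivAt.comp (g := fun z : EuclideanSpace ℝ (Fin (n + 1)) => ‖z‖ ^ 2) x
        (hasStrictFDerivAt_norm_sq (x - closestPoint M x)).hasFDerivAt h1
    refine h2.congr_fderiv ?_
    ext u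
    have := hcpd x hx u
    rw [inner_sub_left] at this
    simpa using this
  -- A function of the distance alone: zero off the open ε-tube, and eventually 1 at each of its
  -- points as k → ∞.
  set χ : ℕ → EuclideanSpace ℝ (Fin (n + 1)) → ℝ :=
    fun k x => Real.smoothTransition (k * (ε ^ 2 - q x)) with hχ
  have hχ0 : ∀ k x, x ∉ thickening ε M → χ k x = 0 := fun k x hx => by
    rw [hqlt, not_lt] at hx
    exact Real.smoothTransition.zero_of_nonpos
      (mul_nonpos_of_nonneg_of_nonpos (by positivity) (by linarith))
  -- Z need not be smooth far from M, but the closed ε-tube lies inside the open r-tube, so χ Z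
  -- vanishes near every point outside the latter.
  have hfar : ∀ k, ∀ x ∉ thickening r M, (fun z => χ k z • Z z) =ᶠ[𝓝 x] fun _ => 0 := by
    intro k x hx
    have : (cthickening ε M)ᶜ ∈ 𝓝 x := isClosed_cthickening.isOpen_compl.mem_nhds fun h =>
      hx (cthickening_subset_thickening' (hε.trans hεr) hεr M h)
    filter_upwards [this] with z hz
    rw [hχ0 k z fun h => hz (thickening_subset_cthickening _ _ h), zero_smul]
  have hχC : ∀ k, ∀ x ∈ thickening r M, ContDiffAt ℝ 1 (χ k) x := fun k x hx =>
    Real.smoothTransition.contDiffAt.comp x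
      (contDiffAt_const.mul (contDiffAt_const.sub (hqC x hx)))
  have hYC : ∀ k, ContDiff ℝ 1 fun x => χ k x • Z x := fun k =>
    contDiff_iff_contDiffAt.2 fun x => by
      by_cases hx : x ∈ thickening r M
      · exact (hχC k x hx).smul (hZ x hx)
      · exact contDiffAt_const.congr_of_eventuallyEq (hfar k x hx)
  have hYc : ∀ k, HasCompactSupport fun x => χ k x • Z x := fun k =>
    HasCompactSupport.intro hM.cthickening fun x hx => by
      rw [hχ0 k x fun h => hx (thickening_subset_cthickening _ _ h), zero_smul]
  -- The other term of the product rule is ∇χ · Z, which vanishes since ∇χ is parallel to x - cp x.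
  have hYtr : ∀ k x, LinearMap.trace ℝ _ (fderiv ℝ (fun z => χ k z • Z z) x).toLinearMap =
      χ k x * τ x := by
    intro k x
    by_cases hx : x ∈ thickening r M
    · have h1 : HasFDerivAt (χ k) (deriv Real.smoothTransition (k * (ε ^ 2 - q x)) •
          ((k : ℝ) • -(2 • innerSL ℝ (x - closestPoint M x) :
            EuclideanSpace ℝ (Fin (n + 1)) →L[ℝ] ℝ))) x := by
        have h2 : HasDerivAt Real.smoothTransition
            (deriv Real.smoothTransition (k * (ε ^ 2 - q x))) (k * (ε ^ 2 - q x)) :=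
          ((Real.smoothTransition.contDiff (n := 1)).differentiable (by norm_num) _).hasDerivAt
        exact h2.comp_hasFDerivAt x (((hqd x hx).const_sub (ε ^ 2)).const_mul (k : ℝ))
      have h3 : HasFDerivAt (fun z => χ k z • Z z) _ x := h1.smul ((hZ x hx).differentiableAt (by norm_num)).hasFDerivAt
      rw [h3.fderiv]
      have h4 : ∀ l : EuclideanSpace ℝ (Fin (n + 1)) →L[ℝ] ℝ, ∀ z,
          LinearMap.trace ℝ _ (l.smulRight z).toLinearMap = l z := fun l z =>
        LinearMap.trace_smulRight (l : EuclideanSpace ℝ (Fin (n + 1)) →ₗ[ℝ] ℝ) z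
      rw [ContinuousLinearMap.toLinearMap_add, map_add, h4, ContinuousLinearMap.toLinearMap_smul,
        map_smul]
      have h5 := hZn x hx
      rw [inner_sub_left] at h5
      simp [hτ, h5]
    · rw [(hfar k x hx).fderiv_eq, hχ0 k x fun h => hx (thickening_mono hεr.le M h)]
      simp
  have hτc : ContinuousOn τ (cthickening ε M) := fun x hx =>
    (continuousAt_trace_fderiv
      (hZ x (cthickening_subset_thickening' (hε.trans hεr) hεr M hx))).continuousWithinAt
  have hτi : Integrable ((cthickening ε M).indicator fun x => ‖τ x‖) :=
    (integrable_indicator_iff isClosed_cthickening.measurableSet).2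
      (hτc.integrableOn_compact hM.cthickening).norm
  have hlim : Tendsto (fun k => ∫ x, χ k x * τ x) atTop
      (𝓝 (∫ x, (thickening ε M).indicator τ x)) := by
    -- The dominating function is |div Z| on the closed ε-tube, which is compact.
    refine tendsto_integral_of_dominated_convergence _ (fun k => ?_) hτi (fun k => ?_) ?_
    · simp_rw [← hYtr k]
      refine Continuous.aestronglyMeasurable ?_
      exact continuous_iff_continuousAt.2 fun x => continuousAt_trace_fderiv (hYC k).contDiffAt
    · refine Eventually.of_forall fun x => ?_
      by_cases hx : x ∈ thickening ε M
      · rw [indicator_of_mem (thickening_subset_cthickening _ _ hx), norm_mul]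
        refine mul_le_of_le_one_left (norm_nonneg _) ?_
        rw [Real.norm_eq_abs, abs_of_nonneg (Real.smoothTransition.nonneg _)]
        exact Real.smoothTransition.le_one _
      · rw [hχ0 k x hx, zero_mul, norm_zero]
        exact indicator_nonneg (fun _ _ => norm_nonneg _) _
    · refine Eventually.of_forall fun x => ?_
      by_cases hx : x ∈ thickening ε M
      · rw [indicator_of_mem hx]
        have hpos : 0 < ε ^ 2 - q x := sub_pos.2 (hqlt.1 hx)
        have h1 : Tendsto (fun k : ℕ => (k : ℝ) * (ε ^ 2 - q x)) atTop atTop :=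
          tendsto_natCast_atTop_atTop.atTop_mul_const hpos
        refine tendsto_const_nhds.congr' ?_
        filter_upwards [h1.eventually_ge_atTop 1] with k hk
        simp only [hχ]
        rw [Real.smoothTransition.one_of_one_le hk, one_mul]
      · rw [indicator_of_notMem hx]
        simp [hχ0 _ x hx]
  have hzero : ∀ k, ∫ x, χ k x * τ x = 0 := fun k => by
    simp_rw [← hYtr k]
    exact integral_trace_fderiv_eq_zero (hYC k) (hYc k)
  simp_rw [hzero] at hlim
  rw [← integral_indicator isOpen_thickening.measurableSet]
  exact (tendsto_nhds_unique hlim tendsto_const_nhds)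

end Tube

/-! ### Surface integrals as limits of tube averages -/

section Limit

variable {n : ℕ} {M : Set (EuclideanSpace ℝ (Fin (n + 1)))}

lemma ContinuousOn.integrable_of_measure_compl_eq_zero {X : Type*} [TopologicalSpace X]
    [T2Space X] [MeasurableSpace X] [BorelSpace X] {μ : Measure X} [IsFiniteMeasure μ] {N : Set X}
    (hN : IsCompact N) (hμ : μ Nᶜ = 0) {f : X → ℝ} (hf : ContinuousOn f N) : Integrable f μ := by
  have h : μ.restrict N = μ := Measure.restrict_eq_self_of_ae_mem hμ
  rw [← h]
  exact hf.integrableOn_compact' hN hN.isClosed.measurableSet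

lemma surfaceMeasure_compl (hM : IsCompact M) : surfaceMeasure M Mᶜ = 0 := by
  rw [surfaceMeasure, Measure.restrict_apply' hM.isClosed.measurableSet, compl_inter_self,
    measure_empty]

lemma volume_thickening_lt_top (hM : IsCompact M) (ε : ℝ) : volume (thickening ε M) < ⊤ :=
  (measure_mono (thickening_subset_cthickening ε M)).trans_lt hM.cthickening.measure_lt_top

lemma isFiniteMeasure_tubeMeasure (hM : IsCompact M) (ε : ℝ) :
    IsFiniteMeasure (tubeMeasure M ε) := by
  have : IsFiniteMeasure (volume.restrict (thickening ε M)) :=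
    ⟨by simpa using volume_thickening_lt_top hM ε⟩
  exact Measure.isFiniteMeasure_map _ _

lemma tubeMeasure_compl (hM : IsCompact M) (hne : M.Nonempty) {ε : ℝ}
    (hae : AEMeasurable (closestPoint M) (volume.restrict (thickening ε M))) :
    tubeMeasure M ε Mᶜ = 0 := by
  rw [tubeMeasure, Measure.map_apply_of_aemeasurable hae hM.isClosed.measurableSet.compl]
  have : closestPoint M ⁻¹' Mᶜ = ∅ := by
    ext x
    simp [closestPoint_mem hM hne x]
  rw [this, measure_empty]

/-- Comparison with a single tube, whose volume is finite because M is bounded. -/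
lemma IsClosedHypersurface.isFiniteMeasure_surfaceMeasure (hM : IsClosedHypersurface 3 M)
    (hne : M.Nonempty) : IsFiniteMeasure (surfaceMeasure M) := by
  obtain ⟨r, hr, h⟩ := hM.exists_tubeMeasure_le hne (κ := 2) (by norm_num)
  have := isFiniteMeasure_tubeMeasure hM.isCompact (r / 2)
  have h1 := Measure.le_iff'.1 (h (r / 2) (by linarith)).2 univ
  simp only [Measure.smul_apply, smul_eq_mul] at h1
  refine ⟨lt_top_iff_ne_top.2 fun htop => ?_⟩
  rw [htop, ENNReal.mul_top (by simpa using hr)] at h1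
  exact (ENNReal.mul_lt_top (by simp) (measure_lt_top (tubeMeasure M (r / 2)) univ)).ne
    (top_le_iff.1 h1)

/-- For f ≥ 0 the two-sided comparison of measures passes directly to integrals; signed f is handled
later by splitting into positive and negative parts. -/
lemma IsClosedHypersurface.tendsto_integral_tubeMeasure_of_nonneg
    (hM : IsClosedHypersurface 3 M) (hne : M.Nonempty)
    {f : EuclideanSpace ℝ (Fin (n + 1)) → ℝ} (hf : ContinuousOn f M) (hf0 : ∀ y ∈ M, 0 ≤ f y) :
    Tendsto (fun ε => (2 * ε)⁻¹ * ∫ y, f y ∂tubeMeasure M ε) (𝓝[>] 0)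
      (𝓝 (∫ y, f y ∂surfaceMeasure M)) := by
  have := hM.isFiniteMeasure_surfaceMeasure hne
  set I := ∫ y, f y ∂surfaceMeasure M with hI
  have hfσ : Integrable f (surfaceMeasure M) :=
    hf.integrable_of_measure_compl_eq_zero hM.isCompact (surfaceMeasure_compl hM.isCompact)
  have hσ0 : 0 ≤ᵐ[surfaceMeasure M] f := by
    filter_upwards [compl_mem_ae_iff.2 (surfaceMeasure_compl hM.isCompact)] with y hy
    exact hf0 y (by simpa using hy)
  have hI0 : 0 ≤ I := integral_nonneg_of_ae hσ0
  obtain ⟨r₀, hr₀, hmeas⟩ := hM.exists_aemeasurable_closestPoint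
  rw [Metric.tendsto_nhds]
  intro η hη
  -- With κ = 1 + δ the average exceeds I by at most δ I and falls short of it by at most δ (1 + δ)
  -- I ≤ 2 δ I, both less than η.
  set δ : ℝ := min 1 (η / (4 * (I + 1))) with hδ
  have hδ0 : 0 < δ := by positivity
  have hδ1 : δ ≤ 1 := min_le_left _ _
  have hδη : δ * (4 * (I + 1)) ≤ η := by
    rw [← le_div_iff₀ (by positivity)]
    exact min_le_right _ _
  obtain ⟨κ, hκ⟩ : ∃ κ : NNReal, (κ : ℝ) = 1 + δ :=
    ⟨(1 + δ).toNNReal, Real.coe_toNNReal _ (by positivity)⟩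
  have hκ1 : 1 < κ := by
    rw [← NNReal.coe_lt_coe, hκ, NNReal.coe_one]
    linarith
  obtain ⟨r, hr, hle⟩ := hM.exists_tubeMeasure_le hne hκ1
  filter_upwards [Ioo_mem_nhdsGT (lt_min hr hr₀)] with ε ⟨hε0, hε⟩
  have hae := hmeas ε (hε.le.trans (min_le_right _ _))
  obtain ⟨h1, h2⟩ := hle ε (hε.trans_le (min_le_left _ _))
  have := isFiniteMeasure_tubeMeasure hM.isCompact ε
  have hτM := tubeMeasure_compl hM.isCompact hne hae
  have hfτ : Integrable f (tubeMeasure M ε) :=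
    hf.integrable_of_measure_compl_eq_zero hM.isCompact hτM
  have hτ0 : 0 ≤ᵐ[tubeMeasure M ε] f := by
    filter_upwards [compl_mem_ae_iff.2 hτM] with y hy
    exact hf0 y (by simpa using hy)
  set J := ∫ y, f y ∂tubeMeasure M ε with hJ
  have hJ1 : J ≤ (1 + δ) * (2 * ε) * I := by
    have := integral_mono_measure h1 (Measure.ae_smul_measure hσ0 _)
      (hfσ.smul_measure (ENNReal.mul_ne_top ENNReal.coe_ne_top ENNReal.ofReal_ne_top))
    rw [integral_smul_measure, ENNReal.toReal_mul, ENNReal.coe_toReal, hκ,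
      ENNReal.toReal_ofReal (by positivity), smul_eq_mul] at this
    exact this
  have hJ2 : 2 * ε * I ≤ (1 + δ) * J := by
    have := integral_mono_measure h2 (Measure.ae_smul_measure hτ0 _)
      (hfτ.smul_measure ENNReal.coe_ne_top)
    rw [integral_smul_measure, integral_smul_measure, ENNReal.coe_toReal, hκ,
      ENNReal.toReal_ofReal (by positivity), smul_eq_mul, smul_eq_mul] at this
    exact this
  have h2ε : (0 : ℝ) < 2 * ε := by linarith
  have hA1 : (2 * ε)⁻¹ * J ≤ (1 + δ) * I := by
    rw [inv_mul_le_iff₀ h2ε]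
    linarith
  have hA2 : I ≤ (1 + δ) * ((2 * ε)⁻¹ * J) := by
    rw [mul_left_comm, le_inv_mul_iff₀ h2ε]
    exact hJ2
  rw [Real.dist_eq, abs_lt]
  constructor <;> nlinarith [mul_nonneg hδ0.le hI0]

/-- The average over thin tubes tends to the surface integral. -/
lemma IsClosedHypersurface.tendsto_integral_tubeMeasure
    (hM : IsClosedHypersurface 3 M) (hne : M.Nonempty)
    {f : EuclideanSpace ℝ (Fin (n + 1)) → ℝ} (hf : ContinuousOn f M) :
    Tendsto (fun ε => (2 * ε)⁻¹ * ∫ y, f y ∂tubeMeasure M ε) (𝓝[>] 0)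
      (𝓝 (∫ y, f y ∂surfaceMeasure M)) := by
  have := hM.isFiniteMeasure_surfaceMeasure hne
  have hσM := surfaceMeasure_compl hM.isCompact
  obtain ⟨r₀, hr₀, hmeas⟩ := hM.exists_aemeasurable_closestPoint
  have hp : ContinuousOn (fun y => max (f y) 0) M := hf.sup continuousOn_const
  have hm : ContinuousOn (fun y => max (-f y) 0) M := hf.neg.sup continuousOn_const
  have hsub : ∀ y, f y = max (f y) 0 - max (-f y) 0 := fun y =>
    (posPart_sub_negPart (f y)).symm
  have h1 := hM.tendsto_integral_tubeMeasure_of_nonneg hne hp fun _ _ => le_max_right _ _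
  have h2 := hM.tendsto_integral_tubeMeasure_of_nonneg hne hm fun _ _ => le_max_right _ _
  have h3 := h1.sub h2
  rw [← integral_sub (hp.integrable_of_measure_compl_eq_zero hM.isCompact hσM)
    (hm.integrable_of_measure_compl_eq_zero hM.isCompact hσM)] at h3
  simp_rw [← hsub] at h3
  refine h3.congr' ?_
  filter_upwards [Ioo_mem_nhdsGT hr₀] with ε ⟨_, hε⟩
  have := isFiniteMeasure_tubeMeasure hM.isCompact ε
  have hτM := tubeMeasure_compl hM.isCompact hne (hmeas ε hε.le)
  rw [← mul_sub, ← integral_sub (hp.integrable_of_measure_compl_eq_zero hM.isCompact hτM)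
    (hm.integrable_of_measure_compl_eq_zero hM.isCompact hτM)]
  simp_rw [← hsub]

/-- A function with vanishing integrals over all thin tubes has vanishing surface integral. -/
lemma IsClosedHypersurface.integral_eq_zero_of_setIntegral_thickening
    (hM : IsClosedHypersurface 3 M) (hne : M.Nonempty)
    {g : EuclideanSpace ℝ (Fin (n + 1)) → ℝ} {r : ℝ} (hr : 0 < r)
    (hg : ∀ x ∈ thickening r M, ContinuousAt g x)
    (hint : ∀ ε, 0 < ε → ε < r → ∫ x in thickening ε M, g x = 0) :
    ∫ y, g y ∂surfaceMeasure M = 0 := by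
  have hMr : M ⊆ thickening r M := self_subset_thickening hr M
  have hgM : ContinuousOn g M := fun y hy => (hg y (hMr hy)).continuousWithinAt
  obtain ⟨r₀, hr₀, hmeas⟩ := hM.exists_aemeasurable_closestPoint
  have hlim := hM.tendsto_integral_tubeMeasure hne hgM
  have hlim1 := hM.tendsto_integral_tubeMeasure hne (f := fun _ => 1) continuousOn_const
  set I := ∫ y, g y ∂surfaceMeasure M
  set m := ∫ _, (1 : ℝ) ∂surfaceMeasure M
  -- On a thin tube g ∘ cp and g differ by at most η, and g integrates to zero there. So the tube
  -- average of g ∘ cp is at most η times that of 1, which tends to m.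
  have key : ∀ η > 0, |I| ≤ η * m := by
    intro η hη
    obtain ⟨r₁, hr₁, hclose⟩ := hM.exists_thickening_subset
      (p := fun x => |g (closestPoint M x) - g x| ≤ η) (fun y hy => by
        have h1 : Tendsto (fun x => g (closestPoint M x) - g x) (𝓝 y) (𝓝 (g y - g y)) :=
          ((hg y (hMr hy)).tendsto.comp (tendsto_closestPoint hM.isCompact hy)).sub
            (hg y (hMr hy)).tendsto
        rw [sub_self] at h1
        have h2 := h1.abs
        rw [abs_zero] at h2
        exact h2.eventually_le_const hη)
    refine le_of_tendsto_of_tendsto hlim.abs (hlim1.const_mul η) ?_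
    filter_upwards [Ioo_mem_nhdsGT (lt_min hr (lt_min hr₀ hr₁))] with ε ⟨hε0, hε⟩
    have hεr : ε < r := hε.trans_le (min_le_left _ _)
    have hεr₀ : ε ≤ r₀ := hε.le.trans ((min_le_right _ _).trans (min_le_left _ _))
    have hεr₁ : ε ≤ r₁ := hε.le.trans ((min_le_right _ _).trans (min_le_right _ _))
    have hae := hmeas ε hεr₀
    have := isFiniteMeasure_tubeMeasure hM.isCompact ε
    have hgτ : Integrable g (tubeMeasure M ε) :=
      hgM.integrable_of_measure_compl_eq_zero hM.isCompact
        (tubeMeasure_compl hM.isCompact hne hae)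
    have hgv : IntegrableOn g (thickening ε M) := by
      refine IntegrableOn.mono_set ?_ (thickening_subset_cthickening ε M)
      refine ContinuousOn.integrableOn_compact hM.isCompact.cthickening fun x hx => ?_
      exact (hg x (cthickening_subset_thickening' hr hεr M hx)).continuousWithinAt
    have hmap : ∫ y, g y ∂tubeMeasure M ε = ∫ x in thickening ε M, g (closestPoint M x) :=
      integral_map hae hgτ.aestronglyMeasurable
    have hmap1 : ∫ _, (1 : ℝ) ∂tubeMeasure M ε = volume.real (thickening ε M) := by
      rw [tubeMeasure, integral_map hae aestronglyMeasurable_const]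
      simp
    have hcpi : IntegrableOn (fun x => g (closestPoint M x)) (thickening ε M) :=
      hgτ.comp_aemeasurable hae
    have hdiff : ∫ y, g y ∂tubeMeasure M ε =
        ∫ x in thickening ε M, (g (closestPoint M x) - g x) := by
      rw [integral_sub hcpi hgv, hint ε hε0 hεr, sub_zero, hmap]
    have hbound : |∫ y, g y ∂tubeMeasure M ε| ≤ η * volume.real (thickening ε M) := by
      rw [hdiff, ← Real.norm_eq_abs]
      refine norm_setIntegral_le_of_norm_le_const (volume_thickening_lt_top hM.isCompact ε)
        fun x hx => hclose x (thickening_mono hεr₁ M hx)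
    rw [hmap1, abs_mul, abs_of_pos (inv_pos.2 (by linarith : (0 : ℝ) < 2 * ε)), mul_left_comm]
    have hinv : (0 : ℝ) ≤ (2 * ε)⁻¹ := inv_nonneg.2 (by linarith)
    gcongr
  have hm0 : Tendsto (fun η : ℝ => η * m) (𝓝[>] 0) (𝓝 0) := by
    have : Continuous fun η : ℝ => η * m := by fun_prop
    simpa using (this.tendsto 0).mono_left nhdsWithin_le_nhds
  have : |I| ≤ 0 := ge_of_tendsto hm0 (by
    filter_upwards [self_mem_nhdsWithin] with η hη using key η hη)
  exact abs_nonpos_iff.1 this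

end Limit

/-! ### Surface gradient and divergence through extensions -/

section SurfaceCalculus

variable {n : ℕ} {M : Set (EuclideanSpace ℝ (Fin (n + 1)))}
  {F : Type*} [NormedAddCommGroup F] [NormedSpace ℝ F]

/-- The closest-point extension of a `C^k` function, `k ≤ 2`, is `C^k` near `M`. -/
lemma IsClosedHypersurface.contDiffAt_comp_closestPoint (hM : IsClosedHypersurface 3 M)
    {k : WithTop ℕ∞} (hk : k ≤ 2) {f : EuclideanSpace ℝ (Fin (n + 1)) → F}
    (hf : ContDiffOn ℝ k f M) {y : EuclideanSpace ℝ (Fin (n + 1))} (hy : y ∈ M) :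
    ContDiffAt ℝ k (f ∘ closestPoint M) y := by
  have h1 : ContDiffWithinAt ℝ k f M (closestPoint M y) :=
    hf _ (closestPoint_mem hM.isCompact ⟨y, hy⟩ y)
  have h2 : ContDiffWithinAt ℝ k (closestPoint M) univ y :=
    ((hM.contDiffAt_closestPoint hy).of_le hk).contDiffWithinAt
  exact contDiffWithinAt_univ.1
    (h1.comp y h2 fun x _ => closestPoint_mem hM.isCompact ⟨y, hy⟩ x)

/-- Apply the chain rule to (f ∘ cp) ∘ cp = f ∘ cp at y = cp y, where D cp is the projection. -/
lemma IsClosedHypersurface.fderiv_comp_closestPoint_comp_tangentProj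
    (hM : IsClosedHypersurface 3 M) {f : EuclideanSpace ℝ (Fin (n + 1)) → F}
    {y : EuclideanSpace ℝ (Fin (n + 1))} (hy : y ∈ M)
    (hf : DifferentiableAt ℝ (f ∘ closestPoint M) y) :
    fderiv ℝ (f ∘ closestPoint M) y ∘L tangentProj M y = fderiv ℝ (f ∘ closestPoint M) y := by
  have hcp := closestPoint_of_mem hM.isCompact hy
  have h1 : HasFDerivAt (f ∘ closestPoint M) (fderiv ℝ (f ∘ closestPoint M) y)
      (closestPoint M y) := by
    rw [hcp]
    exact hf.hasFDerivAt
  have h2 := h1.comp y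
    ((hM.contDiffAt_closestPoint hy).differentiableAt (by norm_num)).hasFDerivAt
  have h3 : (f ∘ closestPoint M) ∘ closestPoint M = f ∘ closestPoint M := by
    ext x
    simp only [Function.comp_apply]
    rw [closestPoint_closestPoint hM.isCompact ⟨y, hy⟩]
  rw [h3, hM.fderiv_closestPoint hy] at h2
  exact h2.fderiv.symm

lemma IsClosedHypersurface.surfaceGrad_eq (hM : IsClosedHypersurface 3 M)
    {f : EuclideanSpace ℝ (Fin (n + 1)) → ℝ} {y : EuclideanSpace ℝ (Fin (n + 1))} (hy : y ∈ M)
    (hf : DifferentiableAt ℝ (f ∘ closestPoint M) y) :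
    surfaceGrad M f y = ∇ (f ∘ closestPoint M) y := by
  refine ext_inner_right ℝ fun u => ?_
  have h := congrArg (fun l : EuclideanSpace ℝ (Fin (n + 1)) →L[ℝ] ℝ => l u)
    (hM.fderiv_comp_closestPoint_comp_tangentProj hy hf)
  simp only [ContinuousLinearMap.comp_apply] at h
  rw [surfaceGrad, tangentProj, Submodule.inner_starProjection_left_eq_right, gradient,
    toDual_symm_apply, toDual_symm_apply]
  exact h

/-- Cyclicity of the trace moves P to the right of the derivative, where it is absorbed. -/
lemma IsClosedHypersurface.surfaceDiv_eq (hM : IsClosedHypersurface 3 M)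
    {g : EuclideanSpace ℝ (Fin (n + 1)) → EuclideanSpace ℝ (Fin (n + 1))}
    {y : EuclideanSpace ℝ (Fin (n + 1))} (hy : y ∈ M)
    (hg : DifferentiableAt ℝ (g ∘ closestPoint M) y) :
    surfaceDiv M g y = LinearMap.trace ℝ _ (fderiv ℝ (g ∘ closestPoint M) y).toLinearMap := by
  conv_rhs => rw [← hM.fderiv_comp_closestPoint_comp_tangentProj hy hg]
  exact LinearMap.trace_mul_comm ℝ (tangentProj M y).toLinearMap
    (fderiv ℝ (g ∘ closestPoint M) y).toLinearMap

/-- The divergence theorem on a closed hypersurface. -/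
lemma IsClosedHypersurface.integral_surfaceDiv_eq_zero (hM : IsClosedHypersurface 3 M)
    (hne : M.Nonempty)
    {g : EuclideanSpace ℝ (Fin (n + 1)) → EuclideanSpace ℝ (Fin (n + 1))}
    (hg : ∀ y ∈ M, ContDiffAt ℝ 1 (g ∘ closestPoint M) y)
    (hgt : ∀ y ∈ M, g y ∈ tangentSpaceAt M y) :
    ∫ y, surfaceDiv M g y ∂surfaceMeasure M = 0 := by
  obtain ⟨r, hr, h⟩ := hM.exists_thickening_subset fun y hy =>
    ((hM.contDiffAt_closestPoint hy).eventually (by norm_num)).and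
      ((hM.eventually_inner_sub_closestPoint hy).and ((hg y hy).eventually (by norm_num)))
  have hMm : MeasurableSet M := hM.isCompact.isClosed.measurableSet
  have heq : ∫ y, surfaceDiv M g y ∂surfaceMeasure M =
      ∫ y, LinearMap.trace ℝ _ (fderiv ℝ (g ∘ closestPoint M) y).toLinearMap
        ∂surfaceMeasure M :=
    setIntegral_congr_fun hMm fun y hy =>
      hM.surfaceDiv_eq hy ((hg y hy).differentiableAt (by norm_num))
  rw [heq]
  refine hM.integral_eq_zero_of_setIntegral_thickening hne hr
    (fun x hx => continuousAt_trace_fderiv (h x hx).2.2) fun ε hε hεr => ?_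
  exact setIntegral_trace_fderiv_thickening_eq_zero hM.isCompact hne (fun x hx => (h x hx).1)
    (fun x hx => (h x hx).2.1.2) (fun x hx => (h x hx).2.2)
    (fun x hx => (h x hx).2.1.1 _ (hgt _ (closestPoint_mem hM.isCompact hne x))) hε hεr

lemma IsClosedHypersurface.continuousOn_surfaceDiv (hM : IsClosedHypersurface 3 M)
    {g : EuclideanSpace ℝ (Fin (n + 1)) → EuclideanSpace ℝ (Fin (n + 1))}
    (hg : ∀ y ∈ M, ContDiffAt ℝ 1 (g ∘ closestPoint M) y) :
    ContinuousOn (surfaceDiv M g) M :=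
  ContinuousOn.congr (fun y hy => (continuousAt_trace_fderiv (hg y hy)).continuousWithinAt)
    fun y hy => hM.surfaceDiv_eq hy ((hg y hy).differentiableAt (by norm_num))

lemma continuousOn_of_comp_closestPoint (hM : IsCompact M)
    {X : Type*} [TopologicalSpace X] {f : EuclideanSpace ℝ (Fin (n + 1)) → X}
    (hf : ∀ y ∈ M, ContinuousAt (f ∘ closestPoint M) y) : ContinuousOn f M :=
  ContinuousOn.congr (f := f ∘ closestPoint M) (fun y hy => (hf y hy).continuousWithinAt)
    fun y hy => by rw [Function.comp_apply, closestPoint_of_mem hM hy]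

lemma IsClosedHypersurface.contDiffAt_gradient (hM : IsClosedHypersurface 3 M)
    {f : EuclideanSpace ℝ (Fin (n + 1)) → ℝ} (hf : ContDiffOn ℝ 2 f M)
    {y : EuclideanSpace ℝ (Fin (n + 1))} (hy : y ∈ M) :
    ContDiffAt ℝ 1 (∇ (f ∘ closestPoint M)) y :=
  (toDual ℝ (EuclideanSpace ℝ (Fin (n + 1)))).symm.contDiff.contDiffAt.comp y
    ((hM.contDiffAt_comp_closestPoint le_rfl hf hy).fderiv_right (by norm_num))

/-- On M the surface gradient is the ambient gradient of a C^2 extension, hence the restriction of a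
C^1 field. This avoids differentiating P. -/
lemma IsClosedHypersurface.contDiffAt_surfaceGrad_comp (hM : IsClosedHypersurface 3 M)
    {f : EuclideanSpace ℝ (Fin (n + 1)) → ℝ} (hf : ContDiffOn ℝ 2 f M)
    {y : EuclideanSpace ℝ (Fin (n + 1))} (hy : y ∈ M) :
    ContDiffAt ℝ 1 (surfaceGrad M f ∘ closestPoint M) y := by
  have h1 : surfaceGrad M f ∘ closestPoint M = ∇ (f ∘ closestPoint M) ∘ closestPoint M := by
    ext1 x
    have hx := closestPoint_mem hM.isCompact ⟨y, hy⟩ x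
    exact hM.surfaceGrad_eq hx
      ((hM.contDiffAt_comp_closestPoint le_rfl hf hx).differentiableAt (by norm_num))
  rw [h1]
  refine ContDiffAt.comp y ?_ ((hM.contDiffAt_closestPoint hy).of_le (by norm_num))
  rw [closestPoint_of_mem hM.isCompact hy]
  exact hM.contDiffAt_gradient hf hy

variable {T : ℝ}
  {A : EuclideanSpace ℝ (Fin (n + 1)) → ℝ → Matrix (Fin (n + 1)) (Fin (n + 1)) ℝ}
  {t : ℝ} {w : EuclideanSpace ℝ (Fin (n + 1)) → ℝ}

lemma IsClosedHypersurface.contDiffAt_surfaceFlux_comp (hM : IsClosedHypersurface 3 M)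
    (hA : IsDiffusionTensor M T A) (ht : t ∈ Set.Icc 0 T) (hw : ContDiffOn ℝ 2 w M)
    {y : EuclideanSpace ℝ (Fin (n + 1))} (hy : y ∈ M) :
    ContDiffAt ℝ 1 (surfaceFlux M A t w ∘ closestPoint M) y := by
  rw [contDiffAt_piLp]
  intro i
  have h : (fun x => (surfaceFlux M A t w ∘ closestPoint M) x i) = fun x =>
      ∑ j, ((fun z => A z t i j) ∘ closestPoint M) x *
        (surfaceGrad M w ∘ closestPoint M) x j := by
    ext x
    simp [surfaceFlux, Matrix.toLpLin_apply, Matrix.mulVec, dotProduct]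
  rw [h]
  refine ContDiffAt.sum fun j _ => ContDiffAt.mul ?_ ?_
  · exact hM.contDiffAt_comp_closestPoint (by norm_num) (hA.smooth t ht i j) hy
  · exact (contDiffAt_piLp 2).1 (hM.contDiffAt_surfaceGrad_comp hw hy) j

lemma IsDiffusionTensor.surfaceFlux_mem (hA : IsDiffusionTensor M T A) (ht : t ∈ Set.Icc 0 T)
    {y : EuclideanSpace ℝ (Fin (n + 1))} (hy : y ∈ M) :
    surfaceFlux M A t w y ∈ tangentSpaceAt M y :=
  hA.invariant y hy t ht _ (Submodule.starProjection_apply_mem _ _)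

/-- The product rule for the surface divergence. -/
lemma IsClosedHypersurface.surfaceDiv_smul (hM : IsClosedHypersurface 3 M)
    {v : EuclideanSpace ℝ (Fin (n + 1)) → ℝ}
    {g : EuclideanSpace ℝ (Fin (n + 1)) → EuclideanSpace ℝ (Fin (n + 1))}
    {y : EuclideanSpace ℝ (Fin (n + 1))} (hy : y ∈ M)
    (hv : DifferentiableAt ℝ (v ∘ closestPoint M) y)
    (hg : DifferentiableAt ℝ (g ∘ closestPoint M) y) :
    surfaceDiv M (fun z => v z • g z) y =
      v y * surfaceDiv M g y + inner ℝ (surfaceGrad M v y) (g y) := by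
  have hcp := closestPoint_of_mem hM.isCompact hy
  have h1 : HasFDerivAt ((fun z => v z • g z) ∘ closestPoint M) _ y :=
    hv.hasFDerivAt.smul hg.hasFDerivAt
  rw [hM.surfaceDiv_eq hy h1.differentiableAt, hM.surfaceDiv_eq hy hg, hM.surfaceGrad_eq hy hv,
    h1.fderiv, ContinuousLinearMap.toLinearMap_add, map_add, ContinuousLinearMap.toLinearMap_smul,
    map_smul, gradient, toDual_symm_apply]
  have h2 := LinearMap.trace_smulRight
    (fderiv ℝ (v ∘ closestPoint M) y : EuclideanSpace ℝ (Fin (n + 1)) →ₗ[ℝ] ℝ)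
    ((g ∘ closestPoint M) y)
  simp only [Function.comp_apply, hcp, smul_eq_mul] at h2 ⊢
  congr 1

end SurfaceCalculus
end

/-- Green's first identity on a closed hypersurface. A function on a `C^k` hypersurface `M` is of
class `C^j`, `j ≤ k`, exactly if it is `ContDiffOn ℝ j · M`. The first three conclusions say
that the operators are evaluated at differentiable closest-point extensions, the next two that both
integrals exist. -/
theorem mainTheorem8 (n : ℕ) (M : Set (EuclideanSpace ℝ (Fin (n + 1))))
    (hM : IsClosedHypersurface 3 M)
    (v w : EuclideanSpace ℝ (Fin (n + 1)) → ℝ)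
    (hv : ContDiffOn ℝ 2 v M) (hw : ContDiffOn ℝ 2 w M)
    (T : ℝ)
    (A : EuclideanSpace ℝ (Fin (n + 1)) → ℝ → Matrix (Fin (n + 1)) (Fin (n + 1)) ℝ)
    (hA : IsDiffusionTensor M T A) (t : ℝ) (ht : t ∈ Set.Icc 0 T) :
    (∀ y ∈ M, DifferentiableAt ℝ (v ∘ closestPoint M) y) ∧
    (∀ y ∈ M, DifferentiableAt ℝ (w ∘ closestPoint M) y) ∧
    (∀ y ∈ M, DifferentiableAt ℝ (surfaceFlux M A t w ∘ closestPoint M) y) ∧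
    Integrable (fun y => v y * surfaceDiv M (surfaceFlux M A t w) y) (surfaceMeasure M) ∧
    Integrable (fun y => inner ℝ (surfaceGrad M v y) (surfaceFlux M A t w y))
      (surfaceMeasure M) ∧
    ∫ y, v y * surfaceDiv M (surfaceFlux M A t w) y ∂(surfaceMeasure M) =
      -∫ y, inner ℝ (surfaceGrad M v y) (surfaceFlux M A t w y) ∂(surfaceMeasure M) := by
  -- For empty M the closest point is an arbitrary default value, but the surface measure is zero.
  rcases M.eq_empty_or_nonempty with rfl | hne
  · simp [surfaceMeasure]
  have hvC := fun y (hy : y ∈ M) => hM.contDiffAt_comp_closestPoint le_rfl hv hy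
  have hwC := fun y (hy : y ∈ M) => hM.contDiffAt_comp_closestPoint le_rfl hw hy
  have hfC := fun y (hy : y ∈ M) => hM.contDiffAt_surfaceFlux_comp hA ht hw hy
  have hvd := fun y (hy : y ∈ M) => (hvC y hy).differentiableAt (by norm_num)
  have hfd := fun y (hy : y ∈ M) => (hfC y hy).differentiableAt (by norm_num)
  have := hM.isFiniteMeasure_surfaceMeasure hne
  have hσM := surfaceMeasure_compl hM.isCompact
  have hi1 : Integrable (fun y => v y * surfaceDiv M (surfaceFlux M A t w) y)
      (surfaceMeasure M) :=
    (hv.continuousOn.mul (hM.continuousOn_surfaceDiv hfC)).integrable_of_measure_compl_eq_zero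
      hM.isCompact hσM
  have hi2 : Integrable (fun y => inner ℝ (surfaceGrad M v y) (surfaceFlux M A t w y))
      (surfaceMeasure M) := by
    refine ContinuousOn.integrable_of_measure_compl_eq_zero hM.isCompact hσM
      (ContinuousOn.inner ?_ ?_)
    · exact continuousOn_of_comp_closestPoint hM.isCompact fun y hy =>
        (hM.contDiffAt_surfaceGrad_comp hv hy).continuousAt
    · exact continuousOn_of_comp_closestPoint hM.isCompact fun y hy => (hfC y hy).continuousAt
  refine ⟨hvd, fun y hy => (hwC y hy).differentiableAt (by norm_num), hfd, hi1, hi2, ?_⟩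
  -- The divergence theorem for v A ∇w, which is tangential because A preserves tangent spaces.
  have hzero := hM.integral_surfaceDiv_eq_zero hne
    (g := fun z => v z • surfaceFlux M A t w z)
    (fun y hy => ((hvC y hy).of_le (by norm_num)).smul (hfC y hy))
    (fun y hy => Submodule.smul_mem _ _ (hA.surfaceFlux_mem ht hy))
  rw [eq_neg_iff_add_eq_zero, ← integral_add hi1 hi2, ← hzero]
  exact (setIntegral_congr_fun hM.isCompact.isClosed.measurableSet fun y hy =>
    hM.surfaceDiv_smul hy (hvd y hy) (hfd y hy)).symm
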